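/- Let $A_0,\dots,A_m\in\mathbb R^{(d+1)\times(d+1)}$, let $U\subset\mathbb R^m$ be an infinite compact convex set, and let $\mathcal U$ be the set of measurable $u:\mathbb R\to\mathbb R^m$ with $u(t)\in U$ a.e. (modulo equality a.e.), with the weak$^*$-topology of $L^\infty(\mathbb R,\mathbb R^m)=L^1(\mathbb R,\mathbb R^m)^*$ and the shifts $\theta_tu=u(\cdot+t)$. Consider the bilinear control system $\dot x(t)=\bigl(A_0+\sum_{i=1}^m u_i(t)A_i\bigr)x(t)$, $u\in\mathcal U$, on $\mathbb R^{d+1}$ with solutions $\varphi(t,x,u)$ ($t\in\mathbb R$), and the system induced on the real projective space $\mathbb{RP}^d$, $\varphi^{\mathbb P}(t,\mathbb Px,u)=\mathbb P\varphi(t,x,u)$, with control flow $\Phi^{\mathbb P}_t(u,p)=(\theta_tu,\varphi^{\mathbb P}(t,p,u))$ on $\mathcal U\times\mathbb{RP}^d$. Chains are taken with respect to any metric compatible with the topology of $\mathcal U\times\mathbb{RP}^d$; a chain recurrent component is a maximal nonempty chain transitive set of $\Phi^{\mathbb P}$, and a chain control set is the projection to $\mathbb{RP}^d$ of a chain recurrent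 component. For $Q\subset\mathbb{RP}^d$ and $u\in\mathcal U$ let $Q(u)=\{p:\varphi^{\mathbb P}(\mathbb R,p,u)\subset Q\}$. Let $Q$ be a chain control set. Then there are subspaces $\mathcal W(u)\subset\mathbb R^{d+1}$, $u\in\mathcal U$, forming an invariant subbundle of $\mathcal U\times\mathbb R^{d+1}$ (constant dimension, $\{(u,x):x\in\mathcal W(u)\}$ closed, $\varphi(t,\mathcal W(u),u)\subset\mathcal W(\theta_tu)$ for all $t\in\mathbb R$) such that $\{(u,p):p\in\mathbb P\mathcal W(u)\}$ is a chain recurrent component, $Q=\bigcup_{u}\mathbb P\mathcal W(u)$ and $$Q(u)=\mathbb P\mathcal W(u)\quad\text{for all }u\in\mathcal U.$$ Moreover: (i) The set-valued map $u\mapsto Q(u)$ is lower semicontinuous: if $V\subset\mathbb{RP}^d$ is open and $Q(u)\cap V\neq\emptyset$, then $Q(v)\cap V\neq\emptyset$ for all $v$ in some neighborhood of $u$. (ii) $Q$ is isolated: there is a neighborhood $N$ of $Q$ such that for all $(u,p)\in\mathcal U\times\mathbb{RP}^d$, $\varphi^{\mathbb P}(\mathbb R,p,u)\subset N$ implies $\varphi^{\mathbb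 P}(\mathbb R,p,u)\subset Q$. -/

import Mathlib

open MeasureTheory Set Filter Topology
open scoped LinearAlgebra.Projectivization Matrix

/-! ### Linear differential equations with bounded measurable coefficients -/

section LinearODE

variable {E : Type*} [NormedAddCommGroup E] [NormedSpace ℝ E]

lemma linODE_integrable {B : ℝ → E →L[ℝ] E} (hB : AEStronglyMeasurable B volume) {C : ℝ}
    (hC : ∀ᵐ s, ‖B s‖ ≤ C) {f : ℝ → E} (hf : Continuous f) (a b : ℝ) :
    IntervalIntegrable (fun s => B s (f s)) volume a b := by
  have hm : AEStronglyMeasurable (fun s => B s (f s)) volume :=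
    (ContinuousLinearMap.apply ℝ E).flip.aestronglyMeasurable_comp₂ hB hf.aestronglyMeasurable
  refine IntervalIntegrable.mono_fun (f := fun s => C * ‖f s‖)
    ((continuous_const.mul hf.norm).intervalIntegrable a b) hm.restrict ?_
  refine ae_restrict_of_ae ?_
  filter_upwards [hC] with s hs
  calc ‖B s (f s)‖ ≤ ‖B s‖ * ‖f s‖ := (B s).le_opNorm _
    _ ≤ C * ‖f s‖ := by gcongr
    _ ≤ ‖C * ‖f s‖‖ := le_abs_self _

lemma linODE_bound {B : ℝ → E →L[ℝ] E} {C : ℝ} (hC0 : 0 ≤ C)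
    (hC : ∀ᵐ s, ‖B s‖ ≤ C) {f : ℝ → E} {t₀ t M : ℝ} {n : ℕ}
    (hb : ∀ s ∈ uIoc t₀ t, ‖f s‖ ≤ M * ((C * |s - t₀|) ^ n / n.factorial)) :
    ‖∫ s in t₀..t, B s (f s)‖ ≤ M * ((C * |t - t₀|) ^ (n + 1) / (n + 1).factorial) := by
  have h1 : ‖∫ s in t₀..t, B s (f s)‖ ≤
      ∫ s in uIoc t₀ t, (M * C ^ (n + 1) / n.factorial) * |s - t₀| ^ n := by
    rw [intervalIntegral.norm_intervalIntegral_eq]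
    refine norm_integral_le_of_norm_le ?_ ?_
    · exact ((by fun_prop : Continuous fun s : ℝ =>
        (M * C ^ (n + 1) / n.factorial) * |s - t₀| ^ n).intervalIntegrable t₀ t).def'
    · filter_upwards [ae_restrict_of_ae hC, ae_restrict_mem measurableSet_uIoc] with s hs hs'
      calc ‖B s (f s)‖ ≤ ‖B s‖ * ‖f s‖ := (B s).le_opNorm _
        _ ≤ C * (M * ((C * |s - t₀|) ^ n / n.factorial)) := by
            gcongr
            exact hb s hs'
        _ = _ := by ring
  refine h1.trans_eq ?_
  rw [integral_const_mul, integral_pow_abs_sub_uIoc, Nat.factorial_succ]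
  push_cast
  field_simp
  ring

lemma linODE_unique {B : ℝ → E →L[ℝ] E} {C : ℝ} (hC0 : 0 ≤ C)
    (hC : ∀ᵐ s, ‖B s‖ ≤ C) {z : ℝ → E} (hz : Continuous z) {t₀ : ℝ}
    (h : ∀ t, z t = ∫ s in t₀..t, B s (z s)) (t : ℝ) : z t = 0 := by
  obtain ⟨M, hM⟩ := (isCompact_uIcc (a := t₀) (b := t)).exists_bound_of_continuousOn hz.continuousOn
  have key : ∀ n : ℕ, ∀ s ∈ uIcc t₀ t, ‖z s‖ ≤ M * ((C * |s - t₀|) ^ n / n.factorial) := by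
    intro n
    induction n with
    | zero => intro s hs; simpa using hM s hs
    | succ n ih =>
      intro s hs
      rw [h s]
      refine linODE_bound hC0 hC fun r hr => ih r ?_
      exact uIcc_subset_uIcc_left hs (uIoc_subset_uIcc hr)
  have hlim : Tendsto (fun n : ℕ => M * ((C * |t - t₀|) ^ n / n.factorial)) atTop (𝓝 (M * 0)) :=
    (FloorSemiring.tendsto_pow_div_factorial_atTop (C * |t - t₀|)).const_mul M
  rw [mul_zero] at hlim
  exact norm_le_zero_iff.mp (ge_of_tendsto' hlim fun n => key n t right_mem_uIcc)

lemma linODE_exists [CompleteSpace E] {B : ℝ → E →L[ℝ] E} (hB : AEStronglyMeasurable B volume)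
    {C : ℝ} (hC0 : 0 ≤ C) (hC : ∀ᵐ s, ‖B s‖ ≤ C) (x₀ : E) :
    ∃ x : ℝ → E, Continuous x ∧ ∀ t, x t = x₀ + ∫ s in (0 : ℝ)..t, B s (x s) := by
  let a : ℕ → ℝ → E := fun n =>
    Nat.rec (fun _ => x₀) (fun _ f t => ∫ s in (0 : ℝ)..t, B s (f s)) n
  have a0 : ∀ t, a 0 t = x₀ := fun _ => rfl
  have aS : ∀ n t, a (n + 1) t = ∫ s in (0 : ℝ)..t, B s (a n s) := fun _ _ => rfl
  have hac : ∀ n, Continuous (a n) := by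
    intro n
    induction n with
    | zero => exact continuous_const
    | succ n ih =>
      exact intervalIntegral.continuous_primitive (fun p q => linODE_integrable hB hC ih p q) 0
  have hbd : ∀ n t, ‖a n t‖ ≤ ‖x₀‖ * ((C * |t|) ^ n / n.factorial) := by
    intro n
    induction n with
    | zero => intro t; simp [a0]
    | succ n ih =>
      intro t
      rw [aS]
      have := linODE_bound (t₀ := 0) (t := t) (M := ‖x₀‖) (n := n) hC0 hC (f := a n)
        (fun s _ => by simpa using ih s)
      simpa using this
  have hsumR : ∀ R : ℝ, Summable fun n : ℕ => ‖x₀‖ * ((C * R) ^ n / n.factorial) := fun R =>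
    (Real.summable_pow_div_factorial (C * R)).mul_left _
  have hsum : ∀ t, Summable fun n => a n t := fun t =>
    Summable.of_norm_bounded (hsumR |t|) fun n => hbd n t
  have hcont : Continuous fun t => ∑' n, a n t := by
    rw [continuous_iff_continuousAt]
    intro t
    have hon : ContinuousOn (fun t => ∑' n, a n t) (Ioo (-(|t| + 1)) (|t| + 1)) := by
      refine continuousOn_tsum (fun n => (hac n).continuousOn) (hsumR (|t| + 1)) ?_
      intro n s hs
      refine (hbd n s).trans ?_
      have : |s| ≤ |t| + 1 := (abs_lt.mpr hs).le
      gcongr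
    refine hon.continuousAt (Ioo_mem_nhds ?_ ?_)
    · linarith [neg_abs_le t]
    · linarith [le_abs_self t]
  refine ⟨fun t => ∑' n, a n t, hcont, fun t => ?_⟩
  have hint : HasSum (fun n => ∫ s in (0 : ℝ)..t, B s (a n s))
      (∫ s in (0 : ℝ)..t, B s (∑' n, a n s)) := by
    refine intervalIntegral.hasSum_integral_of_dominated_convergence
      (fun n _ => C * (‖x₀‖ * ((C * |t|) ^ n / n.factorial)))
      (fun n => (linODE_integrable hB hC (hac n) 0 t).def'.aestronglyMeasurable) ?_ ?_ ?_ ?_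
    · intro n
      filter_upwards [hC] with s hs hst
      have : |s| ≤ |t| := by
        have := abs_sub_left_of_mem_uIcc (uIoc_subset_uIcc hst)
        simpa using this
      calc ‖B s (a n s)‖ ≤ ‖B s‖ * ‖a n s‖ := (B s).le_opNorm _
        _ ≤ C * (‖x₀‖ * ((C * |s|) ^ n / n.factorial)) := by gcongr; exact hbd n s
        _ ≤ _ := by gcongr
    · exact Eventually.of_forall fun s _ => (hsumR |t|).mul_left C
    · exact intervalIntegrable_const
    · exact Eventually.of_forall fun s _ => (B s).hasSum (hsum s).hasSum
  have hS : ∑' n, a n t = a 0 t + ∑' n, a (n + 1) t := (hsum t).tsum_eq_zero_add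
  simp only [hS, a0, aS, hint.tsum_eq]

end LinearODE

/-! ### Chain recurrence -/

/-- `D` is a metric that induces the topology of `X`. -/
structure IsCompatibleMetric {X : Type*} [TopologicalSpace X] (D : X → X → ℝ) : Prop where
  dist_self : ∀ x, D x x = 0
  eq_of_dist_eq_zero : ∀ x y, D x y = 0 → x = y
  symm : ∀ x y, D x y = D y x
  triangle : ∀ x y z, D x z ≤ D x y + D y z
  isOpen_iff : ∀ s : Set X, IsOpen s ↔ ∀ x ∈ s, ∃ ε > 0, ∀ y, D x y < ε → y ∈ s

/-- There is an `(ε, T)`-chain of `Φ` from `x` to `y`: finitely many points, at least two,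
`x = x₀, x₁, …, xₙ = y` and times `tᵢ ≥ T` with `D (Φ tᵢ xᵢ) xᵢ₊₁ < ε`. -/
def HasChain {X : Type*} (Φ : ℝ → X → X) (D : X → X → ℝ) (ε T : ℝ) : X → X → Prop :=
  Relation.TransGen fun a b => ∃ t : ℝ, T ≤ t ∧ D (Φ t a) b < ε

/-- `y` can be reached from `x` by `(ε, T)`-chains for all `ε, T > 0`. -/
def ChainReaches {X : Type*} (Φ : ℝ → X → X) (D : X → X → ℝ) (x y : X) : Prop :=
  ∀ ε > 0, ∀ T > 0, HasChain Φ D ε T x y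

/-- A chain recurrent component of `Φ`: a maximal nonempty chain transitive set, that is, a class
of the equivalence relation "`x` and `y` are chain reachable from each other" on the chain
recurrent set `{x | ChainReaches Φ D x x}`. -/
def IsChainRecurrentComponent {X : Type*} (Φ : ℝ → X → X) (D : X → X → ℝ) (L : Set X) : Prop :=
  ∃ x, ChainReaches Φ D x x ∧ L = {y | ChainReaches Φ D x y ∧ ChainReaches Φ D y x}

/-! ### Real projective space -/

/-- The `d`-dimensional real projective space. -/
abbrev RealProjectiveSpace (d : ℕ) : Type := ℙ ℝ (Fin (d + 1) → ℝ)

/-- The quotient topology of the canonical projection of the nonzero vectors. -/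
noncomputable instance RealProjectiveSpace.instTopologicalSpace (d : ℕ) :
    TopologicalSpace (RealProjectiveSpace d) :=
  TopologicalSpace.coinduced
    (fun x : {x : Fin (d + 1) → ℝ // x ≠ 0} => Projectivization.mk ℝ x.1 x.2) inferInstance

/-- The projectivization of `W`: the set of all points of projective space that are spanned by a nonzero vector of `W`. -/
def projectiveSubspace {d : ℕ} (W : Submodule ℝ (Fin (d + 1) → ℝ)) : Set (RealProjectiveSpace d) :=
  {p | ∃ (x : Fin (d + 1) → ℝ) (hx : x ≠ 0), x ∈ W ∧ p = Projectivization.mk ℝ x hx}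

/-! ### Bilinear control systems -/

/-- A bilinear control system `x' = (A₀ + ∑ i, u i • A i) x` on `ℝ ^ (d + 1)` with an infinite
compact convex set `U` of control values in `ℝ ^ m`. -/
structure BilinearSystem (d m : ℕ) where
  A₀ : Matrix (Fin (d + 1)) (Fin (d + 1)) ℝ
  A : Fin m → Matrix (Fin (d + 1)) (Fin (d + 1)) ℝ
  U : Set (Fin m → ℝ)
  infinite_U : U.Infinite
  isCompact_U : IsCompact U
  convex_U : Convex ℝ U

namespace BilinearSystem

variable {d m : ℕ} (S : BilinearSystem d m)

/-- The control functions: measurable `u : ℝ → ℝ ^ m` with values in `U` almost everywhere, modulo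
equality almost everywhere. -/
@[ext]
structure Control where
  val : ℝ →ₘ[volume] (Fin m → ℝ)
  mem : ∀ᵐ t, val t ∈ S.U

/-- The weak-* topology of `L^∞ = (L¹)*` on the control functions: the coarsest topology for which
`u ↦ ∫ ⟨u(t), g(t)⟩ dt` is continuous for every integrable `g`. -/
noncomputable instance : TopologicalSpace S.Control :=
  TopologicalSpace.induced
    (fun u (g : {g : ℝ → Fin m → ℝ // Integrable g volume}) => ∫ t, u.val t ⬝ᵥ g.1 t) inferInstance

variable {S}

/-- The shift `θ_t u = u(· + t)`. -/
noncomputable def shift (t : ℝ) (u : S.Control) : S.Control :=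
  ⟨u.val.compMeasurePreserving (fun s => s + t) (measurePreserving_add_right volume t), by
    filter_upwards [u.val.coeFn_compMeasurePreserving (measurePreserving_add_right volume t),
      (measurePreserving_add_right volume t).quasiMeasurePreserving.ae u.mem] with s hs hs'
    rw [hs]
    exact hs'⟩

variable (S) in
/-- The matrix `A₀ + ∑ i, v i • A i`. -/
def coeff (v : Fin m → ℝ) : Matrix (Fin (d + 1)) (Fin (d + 1)) ℝ := S.A₀ + ∑ i, v i • S.A i

/-- `x` is a (Carathéodory) solution on `ℝ` of the system under the control `u`. -/
def IsTrajectory (u : S.Control) (x : ℝ → Fin (d + 1) → ℝ) : Prop :=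
  Continuous x ∧ ∀ t, x t = x 0 + ∫ s in (0 : ℝ)..t, S.coeff (u.val s) *ᵥ x s

variable (S) in
/-- The matrix `S.coeff v` as a continuous linear map. -/
noncomputable def coeffCLM (v : Fin m → ℝ) : (Fin (d + 1) → ℝ) →L[ℝ] (Fin (d + 1) → ℝ) :=
  LinearMap.toContinuousLinearMap (Matrix.toLin' (S.coeff v))

lemma coeffCLM_apply (v : Fin m → ℝ) (x : Fin (d + 1) → ℝ) :
    S.coeffCLM v x = S.coeff v *ᵥ x := rfl

lemma continuous_coeffCLM : Continuous S.coeffCLM := by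
  have h : S.coeffCLM = fun v => LinearMap.toContinuousLinearMap (Matrix.toLin' S.A₀) +
      ∑ i, v i • LinearMap.toContinuousLinearMap (Matrix.toLin' (S.A i)) := by
    funext v
    ext1 x
    simp [coeffCLM, coeff]
  rw [h]
  fun_prop

lemma coeffCLM_bound (u : S.Control) :
    AEStronglyMeasurable (fun s => S.coeffCLM (u.val s)) volume ∧
      ∃ C : ℝ, 0 ≤ C ∧ ∀ᵐ s, ‖S.coeffCLM (u.val s)‖ ≤ C := by
  refine ⟨continuous_coeffCLM.comp_aestronglyMeasurable u.val.aestronglyMeasurable, ?_⟩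
  obtain ⟨C, hC⟩ := S.isCompact_U.exists_bound_of_continuousOn
    (continuous_coeffCLM (S := S)).continuousOn
  refine ⟨max C 0, le_max_right _ _, ?_⟩
  filter_upwards [u.mem] with s hs
  exact (hC _ hs).trans (le_max_left _ _)

lemma exists_isTrajectory (u : S.Control) (x₀ : Fin (d + 1) → ℝ) :
    ∃ x, IsTrajectory u x ∧ x 0 = x₀ := by
  obtain ⟨hB, C, hC0, hC⟩ := coeffCLM_bound u
  obtain ⟨x, hx, h⟩ := linODE_exists hB hC0 hC x₀
  have h0 : x 0 = x₀ := by simpa using h 0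
  exact ⟨x, ⟨hx, fun t => by rw [h0]; exact h t⟩, h0⟩

lemma IsTrajectory.sub {u : S.Control} {x y : ℝ → Fin (d + 1) → ℝ} (hx : IsTrajectory u x)
    (hy : IsTrajectory u y) (c : ℝ) : IsTrajectory u (fun t => x t - c • y t) := by
  obtain ⟨hB, C, -, hC⟩ := coeffCLM_bound u
  refine ⟨hx.1.sub (hy.1.const_smul c), fun t => ?_⟩
  have h1 := linODE_integrable hB hC hx.1 0 t
  have h2 := linODE_integrable hB hC hy.1 0 t
  have h3 : ∫ s in (0 : ℝ)..t, S.coeff (u.val s) *ᵥ (x s - c • y s) =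
      (∫ s in (0 : ℝ)..t, S.coeffCLM (u.val s) (x s)) -
        c • ∫ s in (0 : ℝ)..t, S.coeffCLM (u.val s) (y s) := by
    rw [← intervalIntegral.integral_smul]
    refine Eq.trans ?_ (intervalIntegral.integral_sub h1 (h2.smul c))
    simp [coeffCLM_apply, Matrix.mulVec_sub, Matrix.mulVec_smul]
  have hxt := hx.2 t
  have hyt := hy.2 t
  simp only [coeffCLM_apply] at h3
  simp only [h3]
  rw [hxt, hyt, smul_add]
  abel

/-- A solution that vanishes at one time vanishes identically. -/
lemma IsTrajectory.eq_zero {u : S.Control} {x : ℝ → Fin (d + 1) → ℝ} (hx : IsTrajectory u x)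
    {t₀ : ℝ} (h0 : x t₀ = 0) (t : ℝ) : x t = 0 := by
  obtain ⟨hB, C, hC0, hC⟩ := coeffCLM_bound u
  refine linODE_unique hC0 hC hx.1 (t₀ := t₀) (fun r => ?_) t
  have h1 := linODE_integrable hB hC hx.1
  rw [← intervalIntegral.integral_interval_sub_left (h1 0 r) (h1 0 t₀)]
  have e1 := hx.2 r
  have e2 := hx.2 t₀
  simp only [coeffCLM_apply]
  rw [h0] at e2
  rw [e1, eq_neg_of_add_eq_zero_left e2.symm]
  abel

lemma IsTrajectory.eq_smul {u : S.Control} {x y : ℝ → Fin (d + 1) → ℝ} (hx : IsTrajectory u x)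
    (hy : IsTrajectory u y) {c : ℝ} (h : x 0 = c • y 0) (t : ℝ) : x t = c • y t :=
  sub_eq_zero.mp ((hx.sub hy c).eq_zero (t₀ := 0) (sub_eq_zero.mpr h) t)

/-- The solution `φ(·, x₀, u)` with `φ(0, x₀, u) = x₀`. -/
noncomputable def flow (u : S.Control) (t : ℝ) (x₀ : Fin (d + 1) → ℝ) : Fin (d + 1) → ℝ :=
  (exists_isTrajectory u x₀).choose t

lemma isTrajectory_flow (u : S.Control) (x₀ : Fin (d + 1) → ℝ) :
    IsTrajectory u fun t => flow u t x₀ := (exists_isTrajectory u x₀).choose_spec.1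

lemma flow_zero (u : S.Control) (x₀ : Fin (d + 1) → ℝ) : flow u 0 x₀ = x₀ :=
  (exists_isTrajectory u x₀).choose_spec.2

lemma IsTrajectory.eq_flow {u : S.Control} {x : ℝ → Fin (d + 1) → ℝ} (hx : IsTrajectory u x)
    (t : ℝ) : x t = flow u t (x 0) := by
  simpa using hx.eq_smul (isTrajectory_flow u (x 0)) (c := 1) (by simp [flow_zero]) t

lemma flow_ne_zero (u : S.Control) (t : ℝ) {x₀ : Fin (d + 1) → ℝ} (h : x₀ ≠ 0) :
    flow u t x₀ ≠ 0 := fun h0 =>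
  h (by simpa [flow_zero] using (isTrajectory_flow u x₀).eq_zero h0 0)

/-- The trajectory `φ^ℙ(·, p, u)` of the system induced on projective space,
`φ^ℙ(t, ℙ x, u) = ℙ φ(t, x, u)`. -/
noncomputable def projFlow (u : S.Control) (t : ℝ) (p : RealProjectiveSpace d) :
    RealProjectiveSpace d :=
  Projectivization.mk ℝ (flow u t p.rep) (flow_ne_zero u t p.rep_nonzero)

/-- The induced trajectory does not depend on the representative. -/
lemma projFlow_mk (u : S.Control) (t : ℝ) (x : Fin (d + 1) → ℝ) (hx : x ≠ 0) :
    projFlow u t (Projectivization.mk ℝ x hx) =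
      Projectivization.mk ℝ (flow u t x) (flow_ne_zero u t hx) := by
  obtain ⟨a, ha⟩ := Projectivization.exists_smul_eq_mk_rep ℝ x hx
  refine (Projectivization.mk_eq_mk_iff' ℝ _ _ _ _).mpr ⟨(a : ℝ), ?_⟩
  refine ((isTrajectory_flow u _).eq_smul (isTrajectory_flow u x) ?_ t).symm
  simp only [flow_zero]
  exact ha.symm

variable (S) in
/-- The control flow `Φ^ℙ_t(u, p) = (θ_t u, φ^ℙ(t, p, u))` on `Control × ℝP^d`. -/
noncomputable def controlFlow (t : ℝ) (q : S.Control × RealProjectiveSpace d) :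
    S.Control × RealProjectiveSpace d :=
  (shift t q.1, projFlow q.1 t q.2)

variable (S) in
/-- A chain control set on projective space: the projection of a chain recurrent component of the
control flow. Here `D` is a metric on `Control × ℝP^d`. -/
def IsChainControlSet
    (D : S.Control × RealProjectiveSpace d → S.Control × RealProjectiveSpace d → ℝ)
    (Q : Set (RealProjectiveSpace d)) : Prop :=
  ∃ L, IsChainRecurrentComponent S.controlFlow D L ∧ Q = Prod.snd '' L

variable (S) in
/-- The `u`-fiber `Q(u) = {p | φ^ℙ(ℝ, p, u) ⊆ Q}`. -/
def fiber (Q : Set (RealProjectiveSpace d)) (u : S.Control) : Set (RealProjectiveSpace d) :=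
  {p | ∀ t : ℝ, projFlow u t p ∈ Q}

/-- The subspaces `W u` are the fibers of an invariant subbundle of the trivial vector bundle
`Control × ℝ ^ (d + 1)`: they have constant dimension, form a closed set and are mapped into each
other by the linear control flow. -/
structure IsInvariantSubbundle (W : S.Control → Submodule ℝ (Fin (d + 1) → ℝ)) : Prop where
  finrank_eq : ∀ u v, Module.finrank ℝ (W u) = Module.finrank ℝ (W v)
  isClosed : IsClosed {q : S.Control × (Fin (d + 1) → ℝ) | q.2 ∈ W q.1}
  flow_mem : ∀ u t, ∀ x ∈ W u, flow u t x ∈ W (shift t u)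

end BilinearSystem

/-! This is Selgrade's theorem for the control flow, with concatenation of controls in place of
chain transitivity of the base, together with the fact that a chain control set determines its lift.

Fix `q` in the chain recurrent component `L`. The points reachable from `q` by `(ε, T)`-chains form
a trapping region, so the chain-forward set of `q` is a decreasing intersection of attractors, and
the chain-backward set is a decreasing intersection of repellers. `L` is the intersection of these
two sets.

Every attractor and every repeller in `Control × ℝP^d` has linear fibers (`false_of_segment`,
`add_mem_of_mem`). Consider a projective segment with end points in an attractor and interior
outside it. In backward time, limits of interior points lie in the repeller and also accumulate at a
limit of an end point, which lies in the attractor. Any two controls can be joined by a control that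
follows the first and later the second. Hence the fiber dimensions do not depend on the control, and
those of an attractor and its repeller add up to `d + 1` (`IsAttractorRepellerPair.finrank_add`).
The two decreasing sequences therefore become stationary and `L = A ∩ R` for one attractor `A` and
one repeller `R`. If `B` is the attractor of `R`, then `A ∪ B` is an attractor, hence fiberwise
linear, so the fibers of `A` and `B` are nested. This makes the dimension of the fibers of `A ∩ R`
constant (`finrank_inf_eq`).

For `Q(u) = ℙ W(u)` one needs that an orbit staying in `Q`, under whatever control, lies in `L`.
Chains inside `L` can be imitated so that only the projective component jumps, while the control is
glued together in advance (`exists_controlled_chain`). Since weak-* closeness only sees large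
bounded time windows, such chains can be attached to any orbit in `Q` (`chainReaches_of_orbits`).
Lower semicontinuity follows from closedness and constant dimension of the bundle. Isolation of `Q`
follows from that of `A ∩ R`, because by compactness an orbit near `Q` lifts to an orbit near `L`.
-/

namespace BilinearSystem

variable {d m : ℕ} {S : BilinearSystem d m}

/-! ### The space of controls -/

variable (S) in
lemma exists_control_bound :
    ∃ C : ℝ, 0 ≤ C ∧ ∀ u : S.Control, ∀ᵐ s, ‖u.val s‖ ≤ C := by
  obtain ⟨C, hC⟩ := S.isCompact_U.exists_bound_of_continuousOn continuous_id.continuousOn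
  refine ⟨max C 0, le_max_right _ _, fun u => ?_⟩
  filter_upwards [u.mem] with s hs
  exact (hC _ hs).trans (le_max_left _ _)

lemma Control.integrableOn (u : S.Control) {E : Set ℝ} (hE : volume E ≠ ⊤) :
    IntegrableOn (fun t => u.val t) E := by
  obtain ⟨C, -, hC⟩ := exists_control_bound S
  exact Measure.integrableOn_of_bounded hE u.val.aestronglyMeasurable (ae_restrict_of_ae (hC u))

lemma Control.intervalIntegrable (u : S.Control) (a b : ℝ) :
    IntervalIntegrable (fun t => u.val t) volume a b :=
  ⟨u.integrableOn measure_Ioc_lt_top.ne, u.integrableOn measure_Ioc_lt_top.ne⟩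

lemma tendsto_control_iff {ι : Type*} {F : Filter ι} {v : ι → S.Control} {u : S.Control} :
    Tendsto v F (𝓝 u) ↔ ∀ g : ℝ → Fin m → ℝ, Integrable g →
      Tendsto (fun i => ∫ t, (v i).val t ⬝ᵥ g t) F (𝓝 (∫ t, u.val t ⬝ᵥ g t)) := by
  rw [nhds_induced, tendsto_comap_iff, tendsto_pi_nhds]
  exact ⟨fun h g hg => h ⟨g, hg⟩, fun h g => h g.1 g.2⟩

lemma norm_setIntegral_control_le {C : ℝ} {u : S.Control} (hC : ∀ᵐ s, ‖u.val s‖ ≤ C)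
    {E : Set ℝ} (hE : volume E ≠ ⊤) : ‖∫ t in E, u.val t‖ ≤ C * (volume E).toReal :=
  norm_setIntegral_le_of_norm_le_const_ae hE.lt_top (by filter_upwards [ae_restrict_of_ae hC] with s hs using hs)

lemma norm_intervalIntegral_control_le {C : ℝ} {u : S.Control} (hC : ∀ᵐ s, ‖u.val s‖ ≤ C)
    (a b : ℝ) : ‖∫ t in a..b, u.val t‖ ≤ C * |b - a| :=
  intervalIntegral.norm_integral_le_of_norm_le_const_ae
    (by filter_upwards [hC] with s hs _ using hs)

lemma tendsto_setIntegral_iUnion {ι : Type*} {F : Filter ι} {v : ι → S.Control} {u : S.Control}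
    {κ : Type*} [Countable κ] {E : κ → Set ℝ} (hm : ∀ k, MeasurableSet (E k))
    (hd : Pairwise (Function.onFun Disjoint E)) (hE : volume (⋃ k, E k) ≠ ⊤)
    (h : ∀ k, Tendsto (fun i => ∫ t in E k, (v i).val t) F (𝓝 (∫ t in E k, u.val t))) :
    Tendsto (fun i => ∫ t in ⋃ k, E k, (v i).val t) F (𝓝 (∫ t in ⋃ k, E k, u.val t)) := by
  obtain ⟨C, hC0, hC⟩ := exists_control_bound S
  have hs : ∀ w : S.Control, ∫ t in ⋃ k, E k, w.val t = ∑' k, ∫ t in E k, w.val t := fun w =>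
    integral_iUnion hm hd (w.integrableOn hE)
  simp only [hs]
  have hfin : ∀ k, volume (E k) ≠ ⊤ := fun k =>
    ne_top_of_le_ne_top hE (measure_mono (subset_iUnion E k))
  have hsum : Summable fun k => C * (volume (E k)).toReal := by
    refine Summable.mul_left C (ENNReal.summable_toReal ?_)
    rwa [← measure_iUnion hd hm]
  exact tendsto_tsum_of_dominated_convergence hsum h
    (Eventually.of_forall fun i k => norm_setIntegral_control_le (hC _) (hfin k))

/-- A π-λ argument starting from half-lines, carried out inside a bounded interval so that
complements keep finite measure. A general set is then cut along the integer partition of the line.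
-/
lemma tendsto_setIntegral_of_intervals {ι : Type*} {F : Filter ι} {v : ι → S.Control}
    {u : S.Control} (h : ∀ a b : ℝ, Tendsto (fun i => ∫ t in a..b, (v i).val t) F
      (𝓝 (∫ t in a..b, u.val t))) {E : Set ℝ} (hE : MeasurableSet E) (hfin : volume E ≠ ⊤) :
    Tendsto (fun i => ∫ t in E, (v i).val t) F (𝓝 (∫ t in E, u.val t)) := by
  have hloc : ∀ (a b : ℝ), a ≤ b → ∀ E : Set ℝ, MeasurableSet E →
      Tendsto (fun i => ∫ t in E ∩ Ioc a b, (v i).val t) F (𝓝 (∫ t in E ∩ Ioc a b, u.val t)) := by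
    intro a b hab E hE
    have hfin' : ∀ E : Set ℝ, volume (E ∩ Ioc a b) ≠ ⊤ := fun E =>
      ne_top_of_le_ne_top measure_Ioc_lt_top.ne (measure_mono inter_subset_right)
    induction E, hE using MeasurableSpace.induction_on_inter
      (borel_eq_generateFrom_Iic ℝ ▸ (inferInstance : BorelSpace ℝ).measurable_eq) isPiSystem_Iic with
    | empty => simpa using tendsto_const_nhds
    | basic E hE =>
      obtain ⟨c, rfl⟩ := hE
      -- The outer `max` makes the right side empty, as it must be, when `c < a`.
      have hE : Iic c ∩ Ioc a b = Ioc a (max a (min b c)) := by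
        ext x
        simp only [mem_inter_iff, mem_Iic, mem_Ioc, le_max_iff, le_min_iff]
        grind
      simp only [hE, ← intervalIntegral.integral_of_le (le_max_left a (min b c))]
      exact h _ _
    | compl E hE ih =>
      have hw : ∀ w : S.Control, ∫ t in Eᶜ ∩ Ioc a b, w.val t =
          (∫ t in a..b, w.val t) - ∫ t in E ∩ Ioc a b, w.val t := by
        intro w
        rw [intervalIntegral.integral_of_le hab, inter_comm, inter_comm E, eq_sub_iff_add_eq',
          ← sdiff_eq]
        exact integral_inter_add_sdiff hE (w.integrableOn measure_Ioc_lt_top.ne)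
      simp only [hw]
      exact (h a b).sub ih
    | iUnion f hd hm ih =>
      rw [iUnion_inter]
      exact tendsto_setIntegral_iUnion (fun k => (hm k).inter measurableSet_Ioc)
        (fun j k hjk => (hd hjk).mono inter_subset_left inter_subset_left)
        (by rw [← iUnion_inter]; exact hfin' _) ih
  have hU : E = ⋃ n : ℤ, E ∩ Ioc (n : ℝ) (n + 1) := by
    rw [← inter_iUnion, iUnion_Ioc_intCast, inter_univ]
  rw [hU]
  refine tendsto_setIntegral_iUnion (fun k => hE.inter measurableSet_Ioc)
    (fun j k hjk => ((pairwise_disjoint_Ioc_intCast ℝ) hjk).mono inter_subset_right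
      inter_subset_right) (by rwa [← hU]) fun k => hloc _ _ (by linarith) E hE

lemma dotProduct_bound {C : ℝ} {v w : Fin m → ℝ} (h : ‖v‖ ≤ C) :
    |v ⬝ᵥ w| ≤ m * C * ‖w‖ := by
  calc |v ⬝ᵥ w| ≤ ∑ i, |v i * w i| := Finset.abs_sum_le_sum_abs _ _
    _ ≤ ∑ i : Fin m, C * ‖w‖ := by
        refine Finset.sum_le_sum fun i _ => ?_
        rw [abs_mul]
        exact mul_le_mul ((norm_le_pi_norm v i).trans h) (norm_le_pi_norm w i) (abs_nonneg _)
          ((norm_nonneg _).trans h)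
    _ = _ := by simp [mul_assoc]

lemma Control.integrable_dotProduct (u : S.Control) {g : ℝ → Fin m → ℝ} (hg : Integrable g) :
    Integrable fun t => u.val t ⬝ᵥ g t := by
  obtain ⟨C, -, hC⟩ := exists_control_bound S
  refine (hg.norm.const_mul (m * C)).mono' ?_ ?_
  · exact (by fun_prop : Continuous fun p : (Fin m → ℝ) × (Fin m → ℝ) =>
      p.1 ⬝ᵥ p.2).comp_aestronglyMeasurable (u.val.aestronglyMeasurable.prodMk hg.1)
  · filter_upwards [hC u] with t ht using dotProduct_bound ht

/-- Convergence of the primitives implies weak-* convergence of the controls. -/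
lemma tendsto_control_of_intervals {ι : Type*} {F : Filter ι} {v : ι → S.Control}
    {u : S.Control} (h : ∀ a b : ℝ, Tendsto (fun i => ∫ t in a..b, (v i).val t) F
      (𝓝 (∫ t in a..b, u.val t))) : Tendsto v F (𝓝 u) := by
  obtain ⟨C, hC0, hC⟩ := exists_control_bound S
  rw [tendsto_control_iff]
  intro g hg
  refine Integrable.induction (fun g => Tendsto (fun i => ∫ t, (v i).val t ⬝ᵥ g t) F
    (𝓝 (∫ t, u.val t ⬝ᵥ g t))) ?_ ?_ ?_ ?_ hg
  · intro c E hs hfin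
    have hw : ∀ w : S.Control, ∫ t, w.val t ⬝ᵥ E.indicator (fun _ => c) t =
        (∫ t in E, w.val t) ⬝ᵥ c := by
      intro w
      let L : (Fin m → ℝ) →L[ℝ] ℝ := LinearMap.toContinuousLinearMap
        { toFun := fun x => x ⬝ᵥ c
          map_add' := fun x y => add_dotProduct x y c
          map_smul' := fun r x => smul_dotProduct r x c }
      have h1 := L.integral_comp_comm (w.integrableOn hfin.ne)
      refine Eq.trans ?_ h1
      rw [← integral_indicator hs]
      refine integral_congr_ae (Eventually.of_forall fun t => ?_)
      by_cases ht : t ∈ E <;> simp [ht, L]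
    simp only [hw]
    have hc : Continuous fun x : Fin m → ℝ => x ⬝ᵥ c := by fun_prop
    exact (hc.tendsto _).comp (tendsto_setIntegral_of_intervals h hs hfin.ne)
  · intro f g hd hf hg ihf ihg
    have hw : ∀ w : S.Control, ∫ t, w.val t ⬝ᵥ (f + g) t =
        (∫ t, w.val t ⬝ᵥ f t) + ∫ t, w.val t ⬝ᵥ g t := by
      intro w
      rw [← integral_add (w.integrable_dotProduct hf) (w.integrable_dotProduct hg)]
      simp [dotProduct_add]
    simp only [hw]
    exact ihf.add ihg
  -- All controls act on `L¹` with norm at most `m * C`, so convergence of the pairings passes to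
  -- `L¹` limits by an `ε / 3` argument.
  · refine isClosed_of_closure_subset fun f hf => ?_
    simp only [mem_ofPred_eq]
    have hest : ∀ (w : S.Control) (f g : Lp (Fin m → ℝ) 1 (volume : Measure ℝ)),
        dist (∫ t, w.val t ⬝ᵥ f t) (∫ t, w.val t ⬝ᵥ g t) ≤ m * C * dist f g := by
      intro w f g
      have hf := L1.integrable_coeFn f
      have hg := L1.integrable_coeFn g
      rw [Real.dist_eq, ← integral_sub (w.integrable_dotProduct hf) (w.integrable_dotProduct hg),
        dist_eq_norm, L1.norm_eq_integral_norm, ← integral_const_mul, ← Real.norm_eq_abs]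
      refine norm_integral_le_of_norm_le ((L1.integrable_coeFn (f - g)).norm.const_mul _) ?_
      filter_upwards [hC w, Lp.coeFn_sub f g] with t ht hsub
      rw [hsub, ← dotProduct_sub]
      exact dotProduct_bound ht
    rw [Metric.tendsto_nhds]
    intro ε hε
    have hK : 0 < m * C + 1 := by positivity
    obtain ⟨g, hg, hfg⟩ := Metric.mem_closure_iff.mp hf (ε / 3 / (m * C + 1)) (by positivity)
    have hg' : Tendsto (fun i => ∫ t, (v i).val t ⬝ᵥ g t) F (𝓝 (∫ t, u.val t ⬝ᵥ g t)) := hg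
    have hlt : m * C * dist f g < ε / 3 := by
      rw [lt_div_iff₀ hK] at hfg
      nlinarith [dist_nonneg (x := f) (y := g)]
    filter_upwards [Metric.tendsto_nhds.mp hg' (ε / 3) (by positivity)] with i hi
    have h1 := hest (v i) f g
    have h2 := hest u f g
    have h3 := dist_triangle4 (∫ t, (v i).val t ⬝ᵥ f t) (∫ t, (v i).val t ⬝ᵥ g t)
      (∫ t, u.val t ⬝ᵥ g t) (∫ t, u.val t ⬝ᵥ f t)
    rw [dist_comm (∫ t, u.val t ⬝ᵥ g t)] at h3
    linarith
  · intro f g hfg hf ih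
    have hw : ∀ w : S.Control, ∫ t, w.val t ⬝ᵥ g t = ∫ t, w.val t ⬝ᵥ f t := by
      intro w
      refine integral_congr_ae ?_
      filter_upwards [hfg] with t ht
      rw [ht]
    simpa only [hw] using ih

/-- Each coordinate of the integral is a weak-* pairing with an indicator function times a basis
vector. -/
lemma tendsto_intervalIntegral_control {ι : Type*} {F : Filter ι} {v : ι → S.Control}
    {u : S.Control} (h : Tendsto v F (𝓝 u)) (a b : ℝ) :
    Tendsto (fun i => ∫ t in a..b, (v i).val t) F (𝓝 (∫ t in a..b, u.val t)) := by
  have hI : ∀ a b : ℝ, Tendsto (fun i => ∫ t in Ioc a b, (v i).val t) F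
      (𝓝 (∫ t in Ioc a b, u.val t)) := by
    intro a b
    rw [tendsto_pi_nhds]
    intro j
    have hw : ∀ w : S.Control, (∫ t in Ioc a b, w.val t) j =
        ∫ t, w.val t ⬝ᵥ (Ioc a b).indicator (fun _ => Pi.single j 1) t := by
      intro w
      rw [eval_integral (fun i => (w.integrableOn measure_Ioc_lt_top.ne).eval i),
        ← integral_indicator measurableSet_Ioc]
      refine integral_congr_ae (Eventually.of_forall fun t => ?_)
      by_cases ht : t ∈ Ioc a b <;> simp [ht]
    simp only [hw]
    refine tendsto_control_iff.mp h _ ?_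
    exact (integrableOn_const measure_Ioc_lt_top.ne).integrable_indicator measurableSet_Ioc
  exact (hI a b).sub (hI b a)

/-- The control represented by an almost everywhere `U`-valued measurable function. -/
noncomputable def Control.ofFun (f : ℝ → Fin m → ℝ) (hf : AEStronglyMeasurable f volume)
    (hU : ∀ᵐ t, f t ∈ S.U) : S.Control :=
  ⟨AEEqFun.mk f hf, by
    filter_upwards [AEEqFun.coeFn_mk f hf, hU] with t h1 h2
    rwa [h1]⟩

lemma Control.coe_ofFun {f : ℝ → Fin m → ℝ} (hf : AEStronglyMeasurable f volume)
    (hU : ∀ᵐ t, f t ∈ S.U) : ∀ᵐ t, (Control.ofFun f hf hU).val t = f t :=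
  AEEqFun.coeFn_mk f hf

lemma Control.ext_ae {u v : S.Control} (h : ∀ᵐ t, u.val t = v.val t) : u = v :=
  Control.ext (AEEqFun.ext h)

lemma coe_shift (t : ℝ) (u : S.Control) : ∀ᵐ s, (shift t u).val s = u.val (s + t) :=
  u.val.coeFn_compMeasurePreserving (measurePreserving_add_right volume t)

lemma ae_comp_add_right {P : ℝ → Prop} (h : ∀ᵐ s, P s) (t : ℝ) : ∀ᵐ s, P (s + t) :=
  (measurePreserving_add_right volume t).quasiMeasurePreserving.ae h

lemma shift_zero (u : S.Control) : shift 0 u = u := by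
  refine Control.ext_ae ?_
  filter_upwards [coe_shift 0 u] with s hs
  rw [hs, add_zero]

lemma shift_add (s t : ℝ) (u : S.Control) : shift (s + t) u = shift s (shift t u) := by
  refine Control.ext_ae ?_
  filter_upwards [coe_shift (s + t) u, coe_shift s (shift t u),
    ae_comp_add_right (coe_shift t u) s] with r h1 h2 h3
  rw [h1, h2, h3, add_assoc]

lemma integral_shift (t : ℝ) (u : S.Control) (a b : ℝ) :
    ∫ s in a..b, (shift t u).val s = ∫ s in a + t..b + t, u.val s := by
  rw [← intervalIntegral.integral_comp_add_right (fun s => u.val s) t]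
  refine intervalIntegral.integral_congr_ae ?_
  filter_upwards [coe_shift t u] with s hs _ using hs

/-- Moving the interval of integration from shift `t` to shift `p.1` changes the integral by two
pieces of length `|p.1 - t|`, which are small uniformly in the control. -/
lemma continuous_shift : Continuous fun p : ℝ × S.Control => shift p.1 p.2 := by
  obtain ⟨C, hC0, hC⟩ := exists_control_bound S
  rw [continuous_iff_continuousAt]
  rintro ⟨t, u⟩
  refine tendsto_control_of_intervals fun a b => ?_
  simp only [integral_shift]
  have h1 : ∀ c : ℝ, Tendsto (fun p : ℝ × S.Control => ∫ s in c + t..c + p.1, p.2.val s)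
      (𝓝 (t, u)) (𝓝 0) := by
    intro c
    refine squeeze_zero_norm (fun p => norm_intervalIntegral_control_le (hC p.2) _ _) ?_
    have : Continuous fun p : ℝ × S.Control => C * |c + p.1 - (c + t)| := by fun_prop
    simpa using this.tendsto (t, u)
  have h2 := tendsto_intervalIntegral_control (F := 𝓝 (t, u)) (v := fun p : ℝ × S.Control => p.2)
    (u := u) continuous_snd.continuousAt (a + t) (b + t)
  have h3 := (h2.add (h1 b)).sub (h1 a)
  rw [add_zero, sub_zero] at h3
  refine h3.congr fun p => ?_
  have e1 := intervalIntegral.integral_add_adjacent_intervals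
    (p.2.intervalIntegrable (a + t) (b + t)) (p.2.intervalIntegrable (b + t) (b + p.1))
  have e2 := intervalIntegral.integral_add_adjacent_intervals
    (p.2.intervalIntegrable (a + t) (a + p.1)) (p.2.intervalIntegrable (a + p.1) (b + p.1))
  rw [e1, ← e2]
  abel

/-- The set of controls is weak-* compact. -/
instance : CompactSpace S.Control := by
  obtain ⟨C, hC0, hC⟩ := exists_control_bound S
  refine ⟨isCompact_iff_ultrafilter_le_nhds.mpr fun F _ => ?_⟩
  -- Along an ultrafilter the primitives converge pointwise to a Lipschitz function `G`; its
  -- derivative will be the limit control.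
  have hlim : ∀ t : ℝ, ∃ x, Tendsto (fun u : S.Control => ∫ s in (0 : ℝ)..t, u.val s) F (𝓝 x) := by
    intro t
    obtain ⟨x, -, hx⟩ := (isCompact_closedBall (0 : Fin m → ℝ) (C * |t|)).ultrafilter_le_nhds
      (F.map fun u : S.Control => ∫ s in (0 : ℝ)..t, u.val s) (by
        rw [Ultrafilter.coe_map, le_principal_iff, mem_map]
        refine Filter.mem_of_superset univ_mem fun u _ => ?_
        simpa using norm_intervalIntegral_control_le (hC u) 0 t)
    exact ⟨x, hx⟩
  choose G hG using hlim
  have hGi : ∀ a b, Tendsto (fun u : S.Control => ∫ s in a..b, u.val s) F (𝓝 (G b - G a)) := by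
    intro a b
    refine ((hG b).sub (hG a)).congr fun u => ?_
    exact intervalIntegral.integral_interval_sub_left (u.intervalIntegrable _ _)
      (u.intervalIntegrable _ _)
  have hLip : LipschitzWith ⟨C, hC0⟩ G := by
    refine LipschitzWith.of_dist_le_mul fun s t => ?_
    rw [dist_eq_norm, Real.dist_eq]
    exact le_of_tendsto (hGi t s).norm
      (Eventually.of_forall fun u => norm_intervalIntegral_control_le (hC u) _ _)
  have hder := hLip.ae_differentiableAt_real
  -- Difference quotients of `G` are limits of averages of `U`-valued functions, and such averages
  -- stay in the closed convex set `U`.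
  have hmem : ∀ᵐ t, deriv G t ∈ S.U := by
    filter_upwards [hder] with t ht
    have h1 : Tendsto (slope G t) (𝓝[>] t) (𝓝 (deriv G t)) :=
      (hasDerivAt_iff_tendsto_slope.mp ht.hasDerivAt).mono_left
        (nhdsWithin_mono t fun y hy => ne_of_gt hy)
    refine S.isCompact_U.isClosed.mem_of_tendsto h1 ?_
    filter_upwards [self_mem_nhdsWithin] with y hy
    have hy : t < y := hy
    refine S.isCompact_U.isClosed.mem_of_tendsto ((hGi t y).const_smul (y - t)⁻¹)
      (Eventually.of_forall fun u => ?_)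
    have h2 : (⨍ s in Ioc t y, u.val s) ∈ S.U :=
      S.convex_U.set_average_mem S.isCompact_U.isClosed (by simpa using hy)
        measure_Ioc_lt_top.ne (ae_restrict_of_ae u.mem) (u.integrableOn measure_Ioc_lt_top.ne)
    rw [setAverage_eq, ← intervalIntegral.integral_of_le hy.le] at h2
    simpa [hy.le] using h2
  have hint : ∀ a b, ∫ t in a..b, deriv G t = G b - G a := by
    intro a b
    have hb : ∀ᵐ t, ‖deriv G t‖ ≤ C := Eventually.of_forall fun t => norm_deriv_le_of_lipschitz hLip
    have hii : IntervalIntegrable (deriv G) volume a b := by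
      constructor <;>
      exact Measure.integrableOn_of_bounded measure_Ioc_lt_top.ne
        (stronglyMeasurable_deriv G).aestronglyMeasurable (ae_restrict_of_ae hb)
    funext j
    have hj : LipschitzWith ⟨C, hC0⟩ fun t => G t j := by
      have := (LipschitzWith.eval j).comp hLip
      exact this.weaken (one_mul _).le
    have hac := (hj.lipschitzOnWith (s := uIcc a b)).absolutelyContinuousOnInterval
    have h1 := hac.integral_deriv_eq_sub
    have h2 : (∫ t in a..b, deriv G t) j = ∫ t in a..b, (deriv G t) j :=
      ((ContinuousLinearMap.proj (R := ℝ) (φ := fun _ : Fin m => ℝ) j).intervalIntegral_comp_comm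
        hii).symm
    rw [h2, Pi.sub_apply, ← h1]
    refine intervalIntegral.integral_congr_ae ?_
    filter_upwards [hder] with t ht _
    exact ((hasDerivAt_pi.mp ht.hasDerivAt j).deriv).symm
  refine ⟨Control.ofFun (deriv G) (stronglyMeasurable_deriv G).aestronglyMeasurable hmem,
    mem_univ _, ?_⟩
  have : Tendsto (fun u : S.Control => u) F (𝓝 (Control.ofFun (deriv G)
      (stronglyMeasurable_deriv G).aestronglyMeasurable hmem)) := by
    refine tendsto_control_of_intervals fun a b => ?_
    have h1 : ∫ t in a..b, (Control.ofFun (S := S) (deriv G)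
        (stronglyMeasurable_deriv G).aestronglyMeasurable hmem).val t = G b - G a := by
      rw [← hint]
      refine intervalIntegral.integral_congr_ae ?_
      filter_upwards [Control.coe_ofFun (S := S)
        (stronglyMeasurable_deriv G).aestronglyMeasurable hmem] with t ht _ using ht
    rw [h1]
    exact hGi a b
  exact this

/-! ### Gluing controls in time -/

/-- The controls `u` and `v` coincide almost everywhere on `I`. -/
def AgreeOn (I : Set ℝ) (u v : S.Control) : Prop := ∀ᵐ s, s ∈ I → u.val s = v.val s

lemma AgreeOn.mono {I J : Set ℝ} {u v : S.Control} (h : AgreeOn J u v) (hIJ : I ⊆ J) :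
    AgreeOn I u v := by
  filter_upwards [h] with s hs hI using hs (hIJ hI)

lemma AgreeOn.trans {I : Set ℝ} {u v w : S.Control} (h : AgreeOn I u v) (h' : AgreeOn I v w) :
    AgreeOn I u w := by
  filter_upwards [h, h'] with s hs hs' hI using (hs hI).trans (hs' hI)

lemma AgreeOn.shift {I : Set ℝ} {u v : S.Control} (h : AgreeOn I u v) (t : ℝ) :
    AgreeOn {s | s + t ∈ I} (shift t u) (BilinearSystem.shift t v) := by
  filter_upwards [coe_shift t u, coe_shift t v, ae_comp_add_right h t] with s h1 h2 h3 hs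
  rw [h1, h2, h3 hs]

lemma tendsto_of_agreeOn {ι : Type*} {F : Filter ι} {v : ι → S.Control} {u : S.Control}
    (h : ∀ a b : ℝ, ∀ᶠ i in F, AgreeOn (Ioc a b) (v i) u) : Tendsto v F (𝓝 u) := by
  refine tendsto_control_of_intervals fun a b => ?_
  refine tendsto_const_nhds.congr' ?_
  filter_upwards [h (min a b) (max a b)] with i hi
  refine intervalIntegral.integral_congr_ae ?_
  filter_upwards [hi] with s hs hs' using (hs hs').symm

/-- The control that is `u` before time `a` and is `w`, started at time `a`, afterwards. -/
noncomputable def concat (a : ℝ) (u w : S.Control) : S.Control :=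
  Control.ofFun ((Iio a).piecewise u.val (shift (-a) w).val)
    (AEStronglyMeasurable.piecewise measurableSet_Iio u.val.aestronglyMeasurable.restrict
      (shift (-a) w).val.aestronglyMeasurable.restrict) (by
    filter_upwards [u.mem, (shift (-a) w).mem] with t h1 h2
    by_cases ht : t ∈ Iio a <;> simp only [ht, piecewise_eq_of_mem, piecewise_eq_of_notMem,
      not_false_eq_true, h1, h2])

lemma concat_agreeOn_Iio (a : ℝ) (u w : S.Control) : AgreeOn (Iio a) (concat a u w) u := by
  filter_upwards [Control.coe_ofFun (S := S) (f := (Iio a).piecewise u.val (shift (-a) w).val) _ _]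
    with t ht hta
  exact ht.trans (piecewise_eq_of_mem _ _ _ hta)

lemma concat_agreeOn_Ici (a : ℝ) (u w : S.Control) :
    AgreeOn (Ici a) (concat a u w) (shift (-a) w) := by
  filter_upwards [Control.coe_ofFun (S := S) (f := (Iio a).piecewise u.val (shift (-a) w).val) _ _]
    with t ht hta
  exact ht.trans (piecewise_eq_of_notMem _ _ _ (by simpa using hta))

lemma shift_concat_agreeOn (a : ℝ) (u w : S.Control) :
    AgreeOn (Ici 0) (shift a (concat a u w)) w := by
  have h := (concat_agreeOn_Ici a u w).shift a
  rw [← shift_add, add_neg_cancel, shift_zero] at h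
  exact h.mono fun s hs => by simpa using hs

/-! ### The linear flow -/

-- One constant serves all controls, as the values lie in the compact set `U`; all later estimates
-- are therefore uniform in `u`.
variable (S) in
lemma exists_coeff_bound :
    ∃ C : ℝ, 0 ≤ C ∧ ∀ u : S.Control, ∀ᵐ s, ‖S.coeffCLM (u.val s)‖ ≤ C := by
  obtain ⟨C, hC⟩ := S.isCompact_U.exists_bound_of_continuousOn
    (continuous_coeffCLM (S := S)).continuousOn
  refine ⟨max C 0, le_max_right _ _, fun u => ?_⟩
  filter_upwards [u.mem] with s hs
  exact (hC _ hs).trans (le_max_left _ _)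

lemma intervalIntegrable_coeff (u : S.Control) {y : ℝ → Fin (d + 1) → ℝ} (hy : Continuous y)
    (a b : ℝ) : IntervalIntegrable (fun s => S.coeff (u.val s) *ᵥ y s) volume a b := by
  obtain ⟨hB, C, -, hC⟩ := coeffCLM_bound u
  exact linODE_integrable hB hC hy a b

lemma continuous_flow_time (u : S.Control) (x : Fin (d + 1) → ℝ) :
    Continuous fun t => flow u t x := (isTrajectory_flow u x).1

lemma flow_eq_integral (u : S.Control) (t : ℝ) (x : Fin (d + 1) → ℝ) :
    flow u t x = x + ∫ s in (0 : ℝ)..t, S.coeff (u.val s) *ᵥ flow u s x := by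
  have : flow u t x = flow u 0 x + ∫ s in (0 : ℝ)..t, S.coeff (u.val s) *ᵥ flow u s x :=
    (isTrajectory_flow u x).2 t
  rwa [flow_zero] at this

lemma flow_sub_eq_integral (u : S.Control) (s t : ℝ) (x : Fin (d + 1) → ℝ) :
    flow u t x - flow u s x = ∫ r in s..t, S.coeff (u.val r) *ᵥ flow u r x := by
  rw [flow_eq_integral u t, flow_eq_integral u s, add_sub_add_left_eq_sub]
  exact intervalIntegral.integral_interval_sub_left
    (intervalIntegrable_coeff u (continuous_flow_time u x) _ _)
    (intervalIntegrable_coeff u (continuous_flow_time u x) _ _)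

lemma flow_sub_smul (u : S.Control) (t : ℝ) (x y : Fin (d + 1) → ℝ) (c : ℝ) :
    flow u t (x - c • y) = flow u t x - c • flow u t y := by
  have h := ((isTrajectory_flow u x).sub (isTrajectory_flow u y) c).eq_flow t
  simp only [flow_zero] at h
  exact h.symm

lemma flow_apply_zero (u : S.Control) (t : ℝ) : flow u t (0 : Fin (d + 1) → ℝ) = 0 := by
  simpa using flow_sub_smul u t 0 0 1

lemma flow_smul (u : S.Control) (t : ℝ) (x : Fin (d + 1) → ℝ) (c : ℝ) :
    flow u t (c • x) = c • flow u t x := by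
  simpa [flow_apply_zero] using flow_sub_smul u t 0 x (-c)

lemma flow_add (u : S.Control) (t : ℝ) (x y : Fin (d + 1) → ℝ) :
    flow u t (x + y) = flow u t x + flow u t y := by
  simpa using flow_sub_smul u t x y (-1)

lemma flow_cocycle (u : S.Control) (s t : ℝ) (x : Fin (d + 1) → ℝ) :
    flow u (s + t) x = flow (shift t u) s (flow u t x) := by
  have h : IsTrajectory (shift t u) fun s => flow u (s + t) x := by
    refine ⟨(continuous_flow_time u x).comp (continuous_add_const t), fun s => ?_⟩
    beta_reduce
    rw [zero_add, ← sub_eq_iff_eq_add', flow_sub_eq_integral]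
    have h1 := intervalIntegral.integral_comp_add_right (a := 0) (b := s)
      (fun r => S.coeff (u.val r) *ᵥ flow u r x) t
    rw [zero_add] at h1
    rw [← h1]
    refine intervalIntegral.integral_congr_ae ?_
    filter_upwards [coe_shift t u] with r hr _
    rw [hr]
  simpa using h.eq_flow s

lemma flow_neg_flow (u : S.Control) (t : ℝ) (x : Fin (d + 1) → ℝ) :
    flow (shift t u) (-t) (flow u t x) = x := by
  rw [← flow_cocycle, neg_add_cancel, flow_zero]

/-- The time-`t` map of the linear flow. -/
noncomputable def flowEquiv (u : S.Control) (t : ℝ) :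
    (Fin (d + 1) → ℝ) ≃ₗ[ℝ] (Fin (d + 1) → ℝ) where
  toFun := flow u t
  map_add' := flow_add u t
  map_smul' c x := flow_smul u t x c
  invFun := flow (shift t u) (-t)
  left_inv := flow_neg_flow u t
  right_inv x := by
    have h := flow_neg_flow (shift t u) (-t) x
    rwa [← shift_add, neg_add_cancel, shift_zero, neg_neg] at h

/-- The flow on `[0, t]` depends only on the control on `[0, t)`. -/
lemma flow_congr {u v : S.Control} {t : ℝ} (ht : 0 ≤ t) (h : AgreeOn (Ico 0 t) u v)
    (x : Fin (d + 1) → ℝ) : flow u t x = flow v t x := by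
  obtain ⟨hB, C, hC0, hC⟩ := coeffCLM_bound u
  -- The coefficients are cut off outside `(0, t)` and time is clamped to `[0, t]` by `P`. The
  -- difference `z` of the two solutions then solves a linear equation with bounded coefficients on
  -- all of `ℝ`, so `linODE_unique` applies.
  let B : ℝ → (Fin (d + 1) → ℝ) →L[ℝ] (Fin (d + 1) → ℝ) :=
    (Ioo 0 t).indicator fun s => S.coeffCLM (u.val s)
  have hBm : AEStronglyMeasurable B volume := hB.indicator measurableSet_Ioo
  have hBC : ∀ᵐ s, ‖B s‖ ≤ C := by
    filter_upwards [hC] with s hs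
    exact (norm_indicator_le_norm_self _ _).trans hs
  let P : ℝ → ℝ := fun r => max 0 (min r t)
  let z : ℝ → Fin (d + 1) → ℝ := fun r => flow u (P r) x - flow v (P r) x
  have hP : Continuous P := by fun_prop
  have hz : Continuous z :=
    ((continuous_flow_time u x).comp hP).sub ((continuous_flow_time v x).comp hP)
  have hint := linODE_integrable hBm hBC hz
  have hzero : ∀ p q, p ≤ q → (∀ s ∈ Ioc p q, s ∉ Ioo 0 t) → ∫ s in p..q, B s (z s) = 0 := by
    intro p q hpq hs
    rw [intervalIntegral.integral_of_le hpq]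
    refine setIntegral_eq_zero_of_forall_eq_zero fun s hs' => ?_
    simp only [B, indicator_of_notMem (hs s hs'), zero_apply]
  have key : ∀ r, z r = ∫ s in (0 : ℝ)..r, B s (z s) := by
    intro r
    rcases le_total r 0 with hr | hr
    · have hPr : P r = 0 := max_eq_left ((min_le_left _ _).trans hr)
      rw [intervalIntegral.integral_symm, hzero r 0 hr fun s hs hs' => hs'.1.not_ge hs.2]
      simp [z, hPr, flow_zero]
    · have hPr : P r = min r t := max_eq_right (le_min hr ht)
      have hle : min r t ≤ r := min_le_left _ _
      rw [← intervalIntegral.integral_add_adjacent_intervals (hint 0 (min r t))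
        (hint (min r t) r), hzero (min r t) r hle, add_zero]
      · have e : z r = (∫ s in (0 : ℝ)..min r t, S.coeff (u.val s) *ᵥ flow u s x) -
            ∫ s in (0 : ℝ)..min r t, S.coeff (v.val s) *ᵥ flow v s x := by
          simp only [z, hPr]
          rw [flow_eq_integral u (min r t), flow_eq_integral v (min r t),
            add_sub_add_left_eq_sub]
        rw [e, ← intervalIntegral.integral_sub
          (intervalIntegrable_coeff u (continuous_flow_time u x) _ _)
          (intervalIntegrable_coeff v (continuous_flow_time v x) _ _)]
        refine intervalIntegral.integral_congr_ae ?_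
        filter_upwards [h, Measure.ae_ne volume t] with s hs hst hs'
        rw [uIoc_of_le (le_min hr ht)] at hs'
        have hst' : s < t := lt_of_le_of_ne (hs'.2.trans (min_le_right _ _)) hst
        have hmem : s ∈ Ioo 0 t := ⟨hs'.1, hst'⟩
        have hPs : P s = s := by
          simp only [P, min_eq_left hst'.le, max_eq_right hs'.1.le]
        rw [← hs ⟨hs'.1.le, hst'⟩]
        simp only [B, indicator_of_mem hmem, z, hPs, coeffCLM_apply, Matrix.mulVec_sub]
      · intro s hs hs'
        rcases le_total r t with hrt | hrt
        · rw [min_eq_left hrt] at hs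
          exact hs.1.not_ge hs.2
        · rw [min_eq_right hrt] at hs
          exact hs.1.not_gt hs'.2
  have := linODE_unique hC0 hBC hz key t
  have hPt : P t = t := by simp only [P, min_self, max_eq_right ht]
  simpa [z, hPt, sub_eq_zero] using this

lemma norm_integral_coeff_le {C : ℝ} (hC : ∀ u : S.Control, ∀ᵐ s, ‖S.coeffCLM (u.val s)‖ ≤ C)
    (u : S.Control) {y : ℝ → Fin (d + 1) → ℝ} {a b M : ℝ} (hM : ∀ s ∈ uIcc a b, ‖y s‖ ≤ M) :
    ‖∫ s in a..b, S.coeff (u.val s) *ᵥ y s‖ ≤ C * M * |b - a| := by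
  refine intervalIntegral.norm_integral_le_of_norm_le_const_ae ?_
  filter_upwards [hC u] with s hs hs'
  rw [← coeffCLM_apply]
  refine ((S.coeffCLM _).le_opNorm _).trans ?_
  have := hM s (uIoc_subset_uIcc hs')
  gcongr
  exact (norm_nonneg _).trans hs

variable (S) in
lemma exists_flow_bound (T : ℝ) : ∃ M : ℝ, 0 ≤ M ∧ ∀ (u : S.Control) (t : ℝ), |t| ≤ T →
    ∀ x, ‖flow u t x‖ ≤ M * ‖x‖ := by
  obtain ⟨C, hC0, hC⟩ := exists_coeff_bound S
  -- With `C * h ≤ 1 / 2`, the maximum `M` of the norm on `[-h, h]` satisfies `M ≤ ‖x‖ + M / 2`.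
  -- Longer times follow by iterating the cocycle.
  set h : ℝ := 1 / (2 * (C + 1)) with hh
  have hpos : 0 < h := by positivity
  have hCh : C * h ≤ 1 / 2 := by
    rw [hh, mul_one_div, div_le_div_iff₀ (by positivity) (by norm_num)]
    linarith
  have hshort : ∀ (u : S.Control) (t : ℝ), |t| ≤ h → ∀ x, ‖flow u t x‖ ≤ 2 * ‖x‖ := by
    intro u t ht x
    obtain ⟨t₀, ht₀, hmax⟩ := (isCompact_Icc (a := -h) (b := h)).exists_isMaxOn
      ⟨0, by constructor <;> linarith⟩ (continuous_flow_time u x).norm.continuousOn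
    have h1 : ‖flow u t₀ x‖ ≤ ‖x‖ + C * ‖flow u t₀ x‖ * |t₀ - 0| := by
      conv_lhs => rw [flow_eq_integral]
      refine (norm_add_le _ _).trans (add_le_add le_rfl (norm_integral_coeff_le hC u ?_))
      intro s hs
      refine hmax ?_
      exact (uIcc_subset_Icc ⟨by linarith, by linarith⟩ ht₀) hs
    have h2 : |t₀ - 0| ≤ h := by rw [sub_zero]; exact abs_le.mpr ht₀
    have h3 : C * ‖flow u t₀ x‖ * |t₀ - 0| ≤ 1 / 2 * ‖flow u t₀ x‖ := by
      calc C * ‖flow u t₀ x‖ * |t₀ - 0| ≤ C * ‖flow u t₀ x‖ * h := by gcongr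
        _ = C * h * ‖flow u t₀ x‖ := by ring
        _ ≤ _ := by gcongr
    have h4 : ‖flow u t x‖ ≤ ‖flow u t₀ x‖ := hmax (abs_le.mp ht)
    linarith
  have hn : ∀ n : ℕ, ∀ (u : S.Control) (t : ℝ), |t| ≤ n * h → ∀ x,
      ‖flow u t x‖ ≤ 2 ^ n * ‖x‖ := by
    intro n
    induction n with
    | zero =>
      intro u t ht x
      have : t = 0 := by simpa using ht
      simp [this, flow_zero]
    | succ n ih =>
      intro u t ht x
      have hn : (0 : ℝ) < n + 1 := by positivity
      push_cast at ht
      -- Splitting into equal parts treats both signs of `t` at once.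
      have e : t = t / (n + 1) + n * (t / (n + 1)) := by field_simp; ring
      have h1 : |t / (n + 1)| ≤ h := by
        rw [abs_div, abs_of_pos hn, div_le_iff₀ hn]
        linarith
      have h2 : |n * (t / (n + 1))| ≤ n * h := by
        rw [abs_mul, Nat.abs_cast]
        gcongr
      rw [e, flow_cocycle, pow_succ']
      refine (hshort _ _ h1 _).trans ?_
      rw [mul_assoc]
      exact mul_le_mul_of_nonneg_left (ih _ _ h2 _) (by norm_num)
  obtain ⟨n, hn'⟩ := exists_nat_ge (T / h)
  exact ⟨2 ^ n, by positivity, fun u t ht x =>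
    hn n u t (ht.trans ((div_le_iff₀ hpos).mp hn')) x⟩

/-- The integrand is affine in the control. Its `k`-th coordinate pairs the control with `g s j = (A
j *ᵥ y s) k`, an admissible test function once cut off to a bounded interval; two indicators account
for the orientation of `a..b`. -/
lemma tendsto_integral_coeff {ι : Type*} {F : Filter ι} {v : ι → S.Control} {u : S.Control}
    (h : Tendsto v F (𝓝 u)) {y : ℝ → Fin (d + 1) → ℝ} (hy : Continuous y) (a b : ℝ) :
    Tendsto (fun i => ∫ s in a..b, S.coeff ((v i).val s) *ᵥ y s) F
      (𝓝 (∫ s in a..b, S.coeff (u.val s) *ᵥ y s)) := by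
  rw [tendsto_pi_nhds]
  intro k
  let g : ℝ → Fin m → ℝ := fun s j => (S.A j *ᵥ y s) k
  have hg : Continuous g := continuous_pi fun j =>
    (continuous_apply k).comp (Continuous.matrix_mulVec continuous_const hy)
  have hI : ∀ w : S.Control, (∫ s in a..b, S.coeff (w.val s) *ᵥ y s) k =
      (∫ s in a..b, (S.A₀ *ᵥ y s) k) + ((∫ t, w.val t ⬝ᵥ (Ioc a b).indicator g t) -
        ∫ t, w.val t ⬝ᵥ (Ioc b a).indicator g t) := by
    intro w
    have h1 : ∀ p q, ∫ t, w.val t ⬝ᵥ (Ioc p q).indicator g t =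
        ∫ t in Ioc p q, w.val t ⬝ᵥ g t := by
      intro p q
      rw [← integral_indicator measurableSet_Ioc]
      refine integral_congr_ae (Eventually.of_forall fun t => ?_)
      by_cases ht : t ∈ Ioc p q <;> simp [ht]
    have h2 : (∫ s in a..b, S.coeff (w.val s) *ᵥ y s) k =
        ∫ s in a..b, (S.coeff (w.val s) *ᵥ y s) k :=
      ((ContinuousLinearMap.proj (R := ℝ)
        (φ := fun _ : Fin (d + 1) => ℝ) k).intervalIntegral_comp_comm
        (intervalIntegrable_coeff w hy a b)).symm
    have hgi : ∀ p q, IntegrableOn (fun t => w.val t ⬝ᵥ g t) (Ioc p q) := by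
      intro p q
      have := w.integrable_dotProduct
        ((hg.integrableOn_Ioc (a := p) (b := q)).integrable_indicator measurableSet_Ioc)
      refine (this.integrableOn (s := Ioc p q)).congr_fun (fun t ht => ?_) measurableSet_Ioc
      simp [ht]
    rw [h1, h1, h2]
    change _ = _ + ∫ t in a..b, w.val t ⬝ᵥ g t
    rw [← intervalIntegral.integral_add]
    · refine intervalIntegral.integral_congr fun s _ => ?_
      simp [coeff, g, dotProduct, Matrix.add_mulVec, Matrix.sum_mulVec, Matrix.smul_mulVec]
    · exact ((continuous_apply k).comp
        (Continuous.matrix_mulVec continuous_const hy)).intervalIntegrable _ _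
    · exact ⟨hgi a b, hgi b a⟩
  simp only [hI]
  have hind : ∀ p q, Integrable ((Ioc p q).indicator g) := fun p q =>
    (hg.integrableOn_Ioc).integrable_indicator measurableSet_Ioc
  exact tendsto_const_nhds.add ((tendsto_control_iff.mp h _ (hind a b)).sub
    (tendsto_control_iff.mp h _ (hind b a)))

lemma exists_flow_lipschitz (T R : ℝ) (hR : 0 ≤ R) : ∃ K : ℝ, 0 ≤ K ∧
    ∀ (u : S.Control) (x : Fin (d + 1) → ℝ), ‖x‖ ≤ R → ∀ s t : ℝ, |s| ≤ T → |t| ≤ T →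
      ‖flow u t x - flow u s x‖ ≤ K * |t - s| := by
  obtain ⟨C, hC0, hC⟩ := exists_coeff_bound S
  obtain ⟨M, hM0, hM⟩ := exists_flow_bound S T
  refine ⟨C * (M * R), by positivity, fun u x hx s t hs ht => ?_⟩
  rw [flow_sub_eq_integral]
  refine norm_integral_coeff_le hC u fun r hr => ?_
  have hr' : |r| ≤ T := abs_le.mpr ((uIcc_subset_Icc (abs_le.mp hs) (abs_le.mp ht)) hr)
  exact (hM u r hr' x).trans (by gcongr)

/-- Pointwise convergence on a finite net suffices, since the common Lipschitz constant controls the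
rest of `[-T, T]`. -/
lemma tendstoUniformlyOn_of_lipschitz {E ι : Type*} [NormedAddCommGroup E] {F : Filter ι}
    {y : ι → ℝ → E} {z : ℝ → E} {K T : ℝ} (hK : 0 ≤ K)
    (hy : ∀ᶠ i in F, ∀ s t, |s| ≤ T → |t| ≤ T → ‖y i t - y i s‖ ≤ K * |t - s|)
    (hz : ∀ s t, |s| ≤ T → |t| ≤ T → ‖z t - z s‖ ≤ K * |t - s|)
    (h : ∀ t, Tendsto (fun i => y i t) F (𝓝 (z t))) {ε : ℝ} (hε : 0 < ε) :
    ∀ᶠ i in F, ∀ t, |t| ≤ T → ‖y i t - z t‖ ≤ ε := by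
  obtain ⟨N, hNT, hfin, hN⟩ := (isCompact_Icc (a := -T) (b := T)).finite_cover_balls
    (e := ε / 3 / (K + 1)) (by positivity)
  have h1 : ∀ᶠ i in F, ∀ s ∈ N, ‖y i s - z s‖ < ε / 3 := by
    rw [eventually_all_finite hfin]
    intro s _
    have := Metric.tendsto_nhds.mp (h s) (ε / 3) (by positivity)
    simpa [dist_eq_norm] using this
  filter_upwards [h1, hy] with i hi hyi t ht
  obtain ⟨s, hs, hts⟩ := mem_iUnion₂.mp (hN (abs_le.mp ht))
  have hsT : |s| ≤ T := abs_le.mpr (hNT hs)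
  have hst : K * |t - s| ≤ ε / 3 := by
    rw [Metric.mem_ball, Real.dist_eq, lt_div_iff₀ (by positivity)] at hts
    nlinarith [abs_nonneg (t - s)]
  have e : y i t - z t = (y i t - y i s) + (y i s - z s) - (z t - z s) := by abel
  rw [e]
  have := norm_sub_le ((y i t - y i s) + (y i s - z s)) (z t - z s)
  have := norm_add_le (y i t - y i s) (y i s - z s)
  linarith [hyi s t hsT ht, hz s t hsT ht, hi s hs]

/-- Solutions depend continuously on time, control and initial value. -/
lemma continuous_flow :
    Continuous fun p : ℝ × S.Control × (Fin (d + 1) → ℝ) => flow p.2.1 p.1 p.2.2 := by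
  rw [continuous_iff_ultrafilter]
  rintro ⟨t₀, u, x⟩ F hF
  have htF : Tendsto (fun p : ℝ × S.Control × (Fin (d + 1) → ℝ) => p.1) F (𝓝 t₀) :=
    (continuous_fst.tendsto _).mono_left hF
  have huF : Tendsto (fun p : ℝ × S.Control × (Fin (d + 1) → ℝ) => p.2.1) F (𝓝 u) :=
    ((continuous_fst.comp continuous_snd).tendsto _).mono_left hF
  have hxF : Tendsto (fun p : ℝ × S.Control × (Fin (d + 1) → ℝ) => p.2.2) F (𝓝 x) :=
    ((continuous_snd.comp continuous_snd).tendsto _).mono_left hF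
  set R : ℝ := ‖x‖ + 1
  have hR0 : 0 ≤ R := by positivity
  have hR : ∀ᶠ p in (F : Filter (ℝ × S.Control × (Fin (d + 1) → ℝ))), ‖p.2.2‖ ≤ R :=
    hxF.norm.eventually (eventually_le_nhds (lt_add_one _))
  -- Solutions are locally bounded, so they converge pointwise along the ultrafilter. It remains to
  -- see that the limit `y` solves the equation for the limit control.
  have hlim : ∀ t : ℝ, ∃ y, Tendsto (fun p : ℝ × S.Control × (Fin (d + 1) → ℝ) =>
      flow p.2.1 t p.2.2) F (𝓝 y) := by
    intro t
    obtain ⟨M, hM0, hM⟩ := exists_flow_bound S |t|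
    obtain ⟨y, -, hy⟩ := (isCompact_closedBall (0 : Fin (d + 1) → ℝ) (M * R)).ultrafilter_le_nhds
      (F.map fun p : ℝ × S.Control × (Fin (d + 1) → ℝ) => flow p.2.1 t p.2.2) (by
        rw [Ultrafilter.coe_map, le_principal_iff, mem_map]
        filter_upwards [hR] with p hp
        rw [mem_preimage, mem_closedBall_zero_iff]
        exact (hM _ t le_rfl _).trans (by gcongr))
    exact ⟨y, hy⟩
  choose y hy using hlim
  have hyL : ∀ T K : ℝ, (∀ (u : S.Control) (x : Fin (d + 1) → ℝ), ‖x‖ ≤ R →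
      ∀ s t : ℝ, |s| ≤ T → |t| ≤ T → ‖flow u t x - flow u s x‖ ≤ K * |t - s|) →
      ∀ s t, |s| ≤ T → |t| ≤ T → ‖y t - y s‖ ≤ K * |t - s| := by
    intro T K hK s t hs ht
    refine le_of_tendsto ((hy t).sub (hy s)).norm ?_
    filter_upwards [hR] with p hp using hK _ _ hp s t hs ht
  have hyc : Continuous y := by
    rw [continuous_iff_continuousAt]
    intro t
    obtain ⟨K, hK0, hK⟩ := exists_flow_lipschitz (S := S) (|t| + 1) R hR0
    have h1 : Tendsto (fun s => K * |s - t|) (𝓝 t) (𝓝 0) := by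
      have : Continuous fun s => K * |s - t| := by fun_prop
      simpa using this.tendsto t
    rw [ContinuousAt, tendsto_iff_norm_sub_tendsto_zero]
    refine squeeze_zero' (Eventually.of_forall fun s => norm_nonneg _) ?_ h1
    filter_upwards [(continuous_abs.tendsto t).eventually
      (eventually_le_nhds (lt_add_one |t|))] with s hs
    exact hyL _ K hK t s (by linarith) hs
  obtain ⟨C, hC0, hC⟩ := exists_coeff_bound S
  have hy0 : y 0 = x := by
    refine tendsto_nhds_unique (hy 0) ?_
    simpa only [flow_zero] using hxF
  have htraj : IsTrajectory u y := by
    refine ⟨hyc, fun t => ?_⟩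
    obtain ⟨K, hK0, hK⟩ := exists_flow_lipschitz (S := S) |t| R hR0
    -- The coefficients converge only weakly, so one may pass to the limit in the product only after
    -- replacing the solutions by their locally uniform limit `y`.
    have hdiff : Tendsto (fun p : ℝ × S.Control × (Fin (d + 1) → ℝ) =>
        ∫ s in (0 : ℝ)..t, S.coeff (p.2.1.val s) *ᵥ (flow p.2.1 s p.2.2 - y s)) F (𝓝 0) := by
      rw [Metric.tendsto_nhds]
      intro ε hε
      filter_upwards [tendstoUniformlyOn_of_lipschitz (T := |t|) hK0
        (hR.mono fun p hp => hK p.2.1 p.2.2 hp) (hyL _ K hK) hy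
        (ε := ε / (C * |t| + 1)) (by positivity)] with p hp
      rw [dist_zero_right]
      refine (norm_integral_coeff_le hC p.2.1 (M := ε / (C * |t| + 1)) fun s hs => ?_).trans_lt ?_
      · refine hp s ?_
        simpa using abs_sub_left_of_mem_uIcc hs
      · rw [sub_zero, mul_right_comm, mul_div_assoc', div_lt_iff₀ (by positivity)]
        nlinarith
    have hxF' : Tendsto (fun p : ℝ × S.Control × (Fin (d + 1) → ℝ) => p.2.2) F (𝓝 (y 0)) := by
      rwa [hy0]
    have h3 := hxF'.add (hdiff.add (tendsto_integral_coeff huF hyc 0 t))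
    rw [zero_add] at h3
    refine tendsto_nhds_unique (hy t) (h3.congr fun p => ?_)
    rw [flow_eq_integral p.2.1 t p.2.2, ← intervalIntegral.integral_add]
    · simp [Matrix.mulVec_sub]
    · exact intervalIntegrable_coeff _ ((continuous_flow_time _ _).sub hyc) _ _
    · exact intervalIntegrable_coeff _ hyc _ _
  have hyt : y t₀ = flow u t₀ x := by rw [htraj.eq_flow t₀, hy0]
  obtain ⟨K, hK0, hK⟩ := exists_flow_lipschitz (S := S) (|t₀| + 1) R hR0
  have h1 : Tendsto (fun p : ℝ × S.Control × (Fin (d + 1) → ℝ) =>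
      flow p.2.1 p.1 p.2.2 - flow p.2.1 t₀ p.2.2) F (𝓝 0) := by
    have h0 : Tendsto (fun p : ℝ × S.Control × (Fin (d + 1) → ℝ) => K * |p.1 - t₀|) F (𝓝 0) := by
      have : Continuous fun s => K * |s - t₀| := by fun_prop
      simpa [Function.comp_def] using (this.tendsto t₀).comp htF
    refine squeeze_zero_norm' ?_ h0
    filter_upwards [hR, htF.abs.eventually (eventually_le_nhds (lt_add_one |t₀|))] with p hp hpt
    exact hK _ _ hp _ _ (by linarith) hpt
  have h2 := h1.add (hy t₀)
  rw [zero_add, hyt] at h2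
  exact h2.congr fun p => by abel

end BilinearSystem

/-! ### Attractor-repeller pairs and chains -/

section Dynamics

variable {Y : Type*}

/-- `Φ` is a continuous flow on `Y`. -/
structure IsContinuousFlow [TopologicalSpace Y] (Φ : ℝ → Y → Y) : Prop where
  continuous : Continuous fun p : ℝ × Y => Φ p.1 p.2
  map_zero : ∀ y, Φ 0 y = y
  map_add : ∀ s t y, Φ (s + t) y = Φ s (Φ t y)

namespace IsContinuousFlow

variable [TopologicalSpace Y] {Φ : ℝ → Y → Y}

lemma continuous_time (h : IsContinuousFlow Φ) (t : ℝ) : Continuous (Φ t) :=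
  h.continuous.comp (by fun_prop : Continuous fun y : Y => (t, y))

lemma reverse (h : IsContinuousFlow Φ) : IsContinuousFlow fun t => Φ (-t) where
  continuous := h.continuous.comp (by fun_prop : Continuous fun p : ℝ × Y => (-p.1, p.2))
  map_zero y := by rw [neg_zero, h.map_zero]
  map_add s t y := by rw [neg_add, h.map_add]

lemma map_neg_map (h : IsContinuousFlow Φ) (t : ℝ) (y : Y) : Φ t (Φ (-t) y) = y := by
  rw [← h.map_add, add_neg_cancel, h.map_zero]

end IsContinuousFlow

/-- `A` is an attractor of `Φ` with complementary repeller `R`. -/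
structure IsAttractorRepellerPair [TopologicalSpace Y] (Φ : ℝ → Y → Y) (A R : Set Y) : Prop where
  isClosed_left : IsClosed A
  isClosed_right : IsClosed R
  disjoint : Disjoint A R
  map_left : ∀ t, ∀ y ∈ A, Φ t y ∈ A
  map_right : ∀ t, ∀ y ∈ R, Φ t y ∈ R
  -- The starting points may vary near `y`. This uniformity is needed in `finrank_le`, where both
  -- the control and the initial vector change along the sequence.
  backward : ∀ y z, y ∉ A → MapClusterPt z (𝓝 y ×ˢ atBot) (fun p => Φ p.2 p.1) → z ∈ R
  forward : ∀ y z, y ∉ R → MapClusterPt z (𝓝 y ×ˢ atTop) (fun p => Φ p.2 p.1) → z ∈ A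

namespace IsAttractorRepellerPair

variable [TopologicalSpace Y] {Φ : ℝ → Y → Y} {A R A' R' : Set Y}

/-- `O` is a trapping region: once an orbit meets `closure O`, it is in `O` after time `T`. The
attractor consists of the orbits that are always in `O`, the repeller of those that never are. -/
lemma of_trapping (hΦ : IsContinuousFlow Φ) {O : Set Y} (hO : IsOpen O) {T : ℝ}
    (h : ∀ t, T ≤ t → ∀ y ∈ closure O, Φ t y ∈ O) :
    IsAttractorRepellerPair Φ {y | ∀ t, Φ t y ∈ O} {y | ∀ t, Φ t y ∉ O} := by
  -- Replacing `O` by its closure makes the attractor visibly closed and turns leaving it into an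
  -- open condition.
  have hA : {y | ∀ t, Φ t y ∈ O} = {y | ∀ t, Φ t y ∈ closure O} := by
    ext y
    refine ⟨fun hy t => subset_closure (hy t), fun hy t => ?_⟩
    have := h T le_rfl _ (hy (t - T))
    rwa [← hΦ.map_add, add_sub_cancel] at this
  refine ⟨?_, ?_, ?_, ?_, ?_, ?_, ?_⟩
  · rw [hA, ofPred_forall]
    exact isClosed_iInter fun t => isClosed_closure.preimage (hΦ.continuous_time t)
  · rw [ofPred_forall]
    exact isClosed_iInter fun t => hO.isClosed_compl.preimage (hΦ.continuous_time t)
  · exact Set.disjoint_left.mpr fun y h1 h2 => h2 0 (h1 0)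
  · intro t y hy s
    rw [← hΦ.map_add]
    exact hy _
  · intro t y hy s
    rw [← hΦ.map_add]
    exact hy _
  -- If `Φ s z ∈ O`, then orbits starting near `y` are in `O` at very negative times and hence also
  -- at time `t`, where they should be outside `closure O`.
  · intro y z hy hz s hs
    rw [hA] at hy
    simp only [mem_ofPred_eq, not_forall] at hy
    obtain ⟨t, ht⟩ := hy
    have h1 : ∃ᶠ p in 𝓝 y ×ˢ (atBot : Filter ℝ), Φ s (Φ p.2 p.1) ∈ O :=
      mapClusterPt_iff_frequently.mp hz _
        ((hΦ.continuous_time s).continuousAt.preimage_mem_nhds (hO.mem_nhds hs))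
    have h2 : ∀ᶠ p in 𝓝 y ×ˢ (atBot : Filter ℝ), Φ t p.1 ∉ closure O ∧ p.2 ≤ t - T - s :=
      Eventually.prod_mk ((hΦ.continuous_time t).continuousAt.preimage_mem_nhds
        (isClosed_closure.isOpen_compl.mem_nhds ht)) (eventually_le_atBot _)
    obtain ⟨p, hp1, hp2, hp3⟩ := (h1.and_eventually h2).exists
    refine hp2 (subset_closure ?_)
    have := h (t - (s + p.2)) (by linarith) _ (subset_closure hp1)
    rwa [← hΦ.map_add, ← hΦ.map_add, show t - (s + p.2) + s + p.2 = t by ring] at this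
  · intro y z hy hz
    rw [hA]
    intro s
    by_contra hs
    simp only [mem_ofPred_eq, not_forall, not_not] at hy
    obtain ⟨t, ht⟩ := hy
    have h1 : ∃ᶠ p in 𝓝 y ×ˢ (atTop : Filter ℝ), Φ s (Φ p.2 p.1) ∈ (closure O)ᶜ :=
      mapClusterPt_iff_frequently.mp hz _ ((hΦ.continuous_time s).continuousAt.preimage_mem_nhds
        (isClosed_closure.isOpen_compl.mem_nhds hs))
    have h2 : ∀ᶠ p in 𝓝 y ×ˢ (atTop : Filter ℝ), Φ t p.1 ∈ O ∧ t - s + T ≤ p.2 :=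
      Eventually.prod_mk ((hΦ.continuous_time t).continuousAt.preimage_mem_nhds
        (hO.mem_nhds ht)) (eventually_ge_atTop _)
    obtain ⟨p, hp1, hp2, hp3⟩ := (h1.and_eventually h2).exists
    refine hp1 (subset_closure ?_)
    have := h (s + p.2 - t) (by linarith) _ (subset_closure hp2)
    rwa [← hΦ.map_add, sub_add_cancel, hΦ.map_add] at this

lemma reverse (h : IsAttractorRepellerPair (fun t => Φ (-t)) A R) :
    IsAttractorRepellerPair Φ R A where
  isClosed_left := h.isClosed_right
  isClosed_right := h.isClosed_left
  disjoint := h.disjoint.symm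
  map_left t y hy := by simpa using h.map_right (-t) y hy
  map_right t y hy := by simpa using h.map_left (-t) y hy
  backward y z hy hz := h.forward y z hy <| by
    refine MapClusterPt.of_comp (φ := Prod.map id Neg.neg)
      (tendsto_id.prodMap tendsto_neg_atBot_atTop) ?_
    simpa [Function.comp_def] using hz
  forward y z hy hz := h.backward y z hy <| by
    refine MapClusterPt.of_comp (φ := Prod.map id Neg.neg)
      (tendsto_id.prodMap tendsto_neg_atTop_atBot) ?_
    simpa [Function.comp_def] using hz

lemma union (h : IsAttractorRepellerPair Φ A R) (h' : IsAttractorRepellerPair Φ A' R') :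
    IsAttractorRepellerPair Φ (A ∪ A') (R ∩ R') where
  isClosed_left := h.isClosed_left.union h'.isClosed_left
  isClosed_right := h.isClosed_right.inter h'.isClosed_right
  disjoint := Set.disjoint_left.mpr fun y h1 h2 => h1.elim
    (fun h3 => Set.disjoint_left.mp h.disjoint h3 h2.1)
    (fun h3 => Set.disjoint_left.mp h'.disjoint h3 h2.2)
  map_left t y hy := hy.imp (h.map_left t y) (h'.map_left t y)
  map_right t y hy := hy.imp (h.map_right t y) (h'.map_right t y)
  backward y z hy hz := by
    rw [mem_union, not_or] at hy
    exact ⟨h.backward y z hy.1 hz, h'.backward y z hy.2 hz⟩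
  forward y z hy hz := by
    rw [mem_inter_iff, not_and_or] at hy
    exact hy.imp (fun h1 => h.forward y z h1 hz) (fun h1 => h'.forward y z h1 hz)

/-- An orbit that stays in a closed set disjoint from the complementary sets lies in the
intersection of an attractor and a repeller. -/
lemma mem_inter_of_orbit [CompactSpace Y] {B : Set Y} (h : IsAttractorRepellerPair Φ A A')
    (h' : IsAttractorRepellerPair Φ B R) {M : Set Y} (hM : IsClosed M) (h1 : Disjoint M A')
    (h2 : Disjoint M B) {y : Y} (hy : ∀ t, Φ t y ∈ M) : y ∈ A ∩ R := by
  have hcl : ∀ l : Filter ℝ, l.NeBot → ∃ z ∈ M, MapClusterPt z (𝓝 y ×ˢ l) fun p => Φ p.2 p.1 := by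
    intro l hl
    obtain ⟨z, hz, hz'⟩ := hM.isCompact.exists_mapClusterPt (f := l) (u := fun t => Φ t y)
      (by rw [le_principal_iff, mem_map]; exact Filter.mem_of_superset univ_mem fun t _ => hy t)
    refine ⟨z, hz, MapClusterPt.of_comp (φ := fun t => (y, t)) ?_ hz'⟩
    exact (tendsto_const_nhds (x := y)).prodMk tendsto_id
  constructor
  · by_contra hA
    obtain ⟨z, hz, hz'⟩ := hcl atBot inferInstance
    exact Set.disjoint_left.mp h1 hz (h.backward y z hA hz')
  · by_contra hR
    obtain ⟨z, hz, hz'⟩ := hcl atTop inferInstance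
    exact Set.disjoint_left.mp h2 hz (h'.forward y z hR hz')

end IsAttractorRepellerPair

/-! ### Chain reachable sets as intersections of attractors or repellers -/

section Chains

lemma HasChain.mono {Φ : ℝ → Y → Y} {D : Y → Y → ℝ} {ε ε' T T' : ℝ} (hε : ε ≤ ε') (hT : T' ≤ T)
    {x y : Y} (h : HasChain Φ D ε T x y) : HasChain Φ D ε' T' x y :=
  Relation.TransGen.mono (fun _ _ ⟨t, ht, hd⟩ => ⟨t, hT.trans ht, hd.trans_le hε⟩) _ _ h

lemma ChainReaches.trans {Φ : ℝ → Y → Y} {D : Y → Y → ℝ} {x y z : Y}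
    (h : ChainReaches Φ D x y) (h' : ChainReaches Φ D y z) : ChainReaches Φ D x z :=
  fun ε hε T hT => Relation.TransGen.trans (h ε hε T hT) (h' ε hε T hT)

variable [MetricSpace Y] {Φ : ℝ → Y → Y}

lemma isOpen_setOf_hasChain_to (q : Y) (ε T : ℝ) : IsOpen {y | HasChain Φ dist ε T q y} := by
  rw [isOpen_iff_mem_nhds]
  intro y hy
  obtain ⟨a, ha, t, ht, hd⟩ := Relation.TransGen.tail'_iff.mp hy
  have h1 : ∀ᶠ z in 𝓝 y, dist (Φ t a) z < ε :=
    (continuous_const.dist continuous_id).continuousAt.eventually_lt continuousAt_const hd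
  filter_upwards [h1] with z hz
  exact Relation.TransGen.tail' ha ⟨t, ht, hz⟩

lemma isOpen_setOf_hasChain_from (hΦ : IsContinuousFlow Φ) (q : Y) (ε T : ℝ) :
    IsOpen {y | HasChain Φ dist ε T y q} := by
  rw [isOpen_iff_mem_nhds]
  intro y hy
  obtain ⟨a, ⟨t, ht, hd⟩, ha⟩ := Relation.TransGen.head'_iff.mp hy
  have h1 : ∀ᶠ z in 𝓝 y, dist (Φ t z) a < ε :=
    ((hΦ.continuous_time t).dist continuous_const).continuousAt.eventually_lt
      continuousAt_const hd
  filter_upwards [h1] with z hz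
  exact Relation.TransGen.head' ⟨t, ht, hz⟩ ha

/-- The set reachable by `(ε, T)`-chains is a trapping region. If `y` is in its closure, a reachable
`z` near `y` has `Φ t z` within `ε` of `Φ t y`, so one more jump reaches `Φ t y`. -/
lemma isAttractorRepellerPair_chain_to (hΦ : IsContinuousFlow Φ) (q : Y) {ε : ℝ} (hε : 0 < ε)
    (T : ℝ) : IsAttractorRepellerPair Φ {y | ∀ t, HasChain Φ dist ε T q (Φ t y)}
      {y | ∀ t, ¬ HasChain Φ dist ε T q (Φ t y)} := by
  refine IsAttractorRepellerPair.of_trapping hΦ (isOpen_setOf_hasChain_to q ε T) (T := T) ?_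
  intro t ht y hy
  obtain ⟨z, hz1, hz2⟩ := mem_closure_iff_nhds.mp hy {z | dist (Φ t z) (Φ t y) < ε}
    (((hΦ.continuous_time t).dist continuous_const).continuousAt.eventually_lt
      continuousAt_const (by simpa using hε))
  exact Relation.TransGen.tail hz2 ⟨t, ht, hz1⟩

/-- The set from which `q` is reachable traps the reversed flow: from `Φ (-t) y` one flows to `y`
and jumps to a nearby point of the set. -/
lemma isAttractorRepellerPair_chain_from (hΦ : IsContinuousFlow Φ) (q : Y) {ε : ℝ} (hε : 0 < ε)
    (T : ℝ) : IsAttractorRepellerPair Φ {y | ∀ t, ¬ HasChain Φ dist ε T (Φ (-t) y) q}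
      {y | ∀ t, HasChain Φ dist ε T (Φ (-t) y) q} := by
  refine IsAttractorRepellerPair.reverse (IsAttractorRepellerPair.of_trapping hΦ.reverse
    (isOpen_setOf_hasChain_from hΦ q ε T) (T := T) ?_)
  intro t ht y hy
  obtain ⟨z, hz1, hz2⟩ := Metric.mem_closure_iff.mp hy ε hε
  refine Relation.TransGen.head ⟨t, ht, ?_⟩ hz1
  rwa [hΦ.map_neg_map]

/-- The set of points chain reachable from `q` is an intersection of a decreasing sequence of
attractors. -/
lemma exists_attractors_chainReaches [CompactSpace Y] (hΦ : IsContinuousFlow Φ) (q : Y) :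
    ∃ A R : ℕ → Set Y, (∀ n, IsAttractorRepellerPair Φ (A n) (R n)) ∧ Antitone A ∧
      {y | ChainReaches Φ dist q y} = ⋂ n, A n := by
  refine ⟨fun n => {y | ∀ t, HasChain Φ dist (1 / (n + 1)) (n + 1) q (Φ t y)}, _,
    fun n => isAttractorRepellerPair_chain_to hΦ q (by positivity) _, ?_, ?_⟩
  · intro k n hkn y hy t
    exact (hy t).mono (by gcongr) (by gcongr)
  · ext y
    rw [mem_iInter]
    constructor
    · intro hy n t
      -- To end at `Φ t y` instead of `y`, the last leg is prolonged by `t`. Its jump must then be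
      -- small enough to survive `Φ t`, and its duration exceeds `n + 1` by `|t|` to allow for
      -- negative `t`.
      obtain ⟨δ, hδ, hδ'⟩ := Metric.uniformContinuous_iff.mp
        (CompactSpace.uniformContinuous_of_continuous (hΦ.continuous_time t)) (1 / (n + 1))
        (by positivity)
      obtain ⟨a, ha, s, hs, hd⟩ := Relation.TransGen.tail'_iff.mp
        (hy (min (1 / (n + 1)) δ) (lt_min (by positivity) hδ) (n + 1 + |t|) (by positivity))
      refine Relation.TransGen.tail' (b := a) ?_ ⟨t + s, ?_, ?_⟩
      · refine Relation.ReflTransGen.mono ?_ _ _ ha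
        rintro b c ⟨r, hr, hd⟩
        exact ⟨r, by linarith [abs_nonneg t], hd.trans_le (min_le_left _ _)⟩
      · linarith [neg_abs_le t]
      · rw [hΦ.map_add]
        exact hδ' (hd.trans_le (min_le_right _ _))
    · intro hy ε hε T hT
      obtain ⟨n, hn⟩ := exists_nat_gt (max T (1 / ε))
      have h1 := hy n 0
      rw [hΦ.map_zero] at h1
      refine h1.mono ?_ (by linarith [le_max_left T (1 / ε)])
      have := le_max_right T (1 / ε)
      exact (one_div_le (by positivity) hε).mpr (by linarith)

/-- The set of points from which `q` is chain reachable is an intersection of a decreasing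
sequence of repellers. -/
lemma exists_repellers_chainReaches (hΦ : IsContinuousFlow Φ) (q : Y) :
    ∃ A R : ℕ → Set Y, (∀ n, IsAttractorRepellerPair Φ (A n) (R n)) ∧ Antitone R ∧
      {y | ChainReaches Φ dist y q} = ⋂ n, R n := by
  refine ⟨_, fun n => {y | ∀ t, HasChain Φ dist (1 / (n + 1)) (n + 1) (Φ (-t) y) q},
    fun n => isAttractorRepellerPair_chain_from hΦ q (by positivity) _, ?_, ?_⟩
  · intro k n hkn y hy t
    exact (hy t).mono (by gcongr) (by gcongr)
  · ext y
    rw [mem_iInter]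
    constructor
    · intro hy n t
      -- Here the first leg is prolonged; its end point, and so its jump, does not change.
      obtain ⟨a, ⟨s, hs, hd⟩, ha⟩ := Relation.TransGen.head'_iff.mp
        (hy (1 / (n + 1)) (by positivity) (n + 1 + |t|) (by positivity))
      refine Relation.TransGen.head' (b := a) ⟨s + t, ?_, ?_⟩ ?_
      · linarith [neg_abs_le t]
      · rwa [hΦ.map_add, hΦ.map_neg_map]
      · refine Relation.ReflTransGen.mono ?_ _ _ ha
        rintro b c ⟨r, hr, hd⟩
        exact ⟨r, by linarith [abs_nonneg t], hd⟩
    · intro hy ε hε T hT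
      obtain ⟨n, hn⟩ := exists_nat_gt (max T (1 / ε))
      have h1 := hy n 0
      rw [neg_zero, hΦ.map_zero] at h1
      refine h1.mono ?_ (by linarith [le_max_left T (1 / ε)])
      have := le_max_right T (1 / ε)
      exact (one_div_le (by positivity) hε).mpr (by linarith)

end Chains

end Dynamics

/-- The metric space defined by a compatible metric. -/
@[reducible]
noncomputable def IsCompatibleMetric.toMetricSpace {X : Type*} [t : TopologicalSpace X]
    {D : X → X → ℝ} (h : IsCompatibleMetric D) : MetricSpace X :=
  MetricSpace.ofDistTopology D h.dist_self h.symm h.triangle h.isOpen_iff h.eq_of_dist_eq_zero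

/-! ### Projective space and the control flow -/

section Projective

variable {d : ℕ}

lemma projMk_eq_of_smul {x y : Fin (d + 1) → ℝ} (hx : x ≠ 0) (hy : y ≠ 0) {c : ℝ}
    (h : x = c • y) : Projectivization.mk ℝ x hx = Projectivization.mk ℝ y hy :=
  (Projectivization.mk_eq_mk_iff' ℝ _ _ _ _).mpr ⟨c, h.symm⟩

lemma tendsto_projMk {ι : Type*} {F : Filter ι} {x : ι → Fin (d + 1) → ℝ} {y : Fin (d + 1) → ℝ}
    (hx : ∀ i, x i ≠ 0) (hy : y ≠ 0) (h : Tendsto x F (𝓝 y)) :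
    Tendsto (fun i => (Projectivization.mk ℝ (x i) (hx i) : RealProjectiveSpace d)) F
      (𝓝 (Projectivization.mk ℝ y hy)) := by
  have hc : Continuous fun x : {x : Fin (d + 1) → ℝ // x ≠ 0} =>
      (Projectivization.mk ℝ x.1 x.2 : RealProjectiveSpace d) := continuous_coinduced_rng
  have hs : Tendsto (fun i => (⟨x i, hx i⟩ : {x : Fin (d + 1) → ℝ // x ≠ 0})) F (𝓝 ⟨y, hy⟩) :=
    tendsto_subtype_rng.mpr h
  exact (hc.tendsto ⟨y, hy⟩).comp hs

lemma unit_ne_zero {x : Fin (d + 1) → ℝ} (h : ‖x‖ = 1) : x ≠ 0 := by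
  rintro rfl
  simp at h

lemma exists_unit_rep (p : RealProjectiveSpace d) :
    ∃ (x : Fin (d + 1) → ℝ) (hx : ‖x‖ = 1), p = Projectivization.mk ℝ x (unit_ne_zero hx) := by
  have h1 : ‖‖p.rep‖⁻¹ • p.rep‖ = 1 := norm_smul_inv_norm p.rep_nonzero
  refine ⟨_, h1, ?_⟩
  conv_lhs => rw [← p.mk_rep]
  exact (projMk_eq_of_smul (unit_ne_zero h1) p.rep_nonzero rfl).symm

lemma exists_tendsto_unit {ι : Type*} (F : Ultrafilter ι) {x : ι → Fin (d + 1) → ℝ}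
    (hx : ∀ i, ‖x i‖ = 1) : ∃ y, ‖y‖ = 1 ∧ Tendsto x F (𝓝 y) := by
  obtain ⟨y, hy, h⟩ := (isCompact_sphere (0 : Fin (d + 1) → ℝ) 1).ultrafilter_le_nhds (F.map x)
    (by
      rw [Ultrafilter.coe_map, le_principal_iff, mem_map]
      exact Filter.mem_of_superset univ_mem fun i _ => by simp [hx i])
  exact ⟨y, by simpa using hy, h⟩

instance : CompactSpace (RealProjectiveSpace d) := by
  refine ⟨isCompact_iff_ultrafilter_le_nhds.mpr fun F _ => ?_⟩
  choose x hx hp using exists_unit_rep (d := d)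
  obtain ⟨y, hy, h⟩ := exists_tendsto_unit F hx
  refine ⟨Projectivization.mk ℝ y (unit_ne_zero hy), mem_univ _, ?_⟩
  have := tendsto_projMk (fun p => unit_ne_zero (hx p)) (unit_ne_zero hy) h
  simp only [← hp] at this
  exact tendsto_id'.mp this

end Projective

namespace BilinearSystem

variable {d m : ℕ} {S : BilinearSystem d m}

lemma controlFlow_mk (t : ℝ) (u : S.Control) (x : Fin (d + 1) → ℝ) (hx : x ≠ 0) :
    S.controlFlow t (u, Projectivization.mk ℝ x hx) =
      (shift t u, Projectivization.mk ℝ (flow u t x) (flow_ne_zero u t hx)) := by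
  rw [controlFlow, projFlow_mk]

lemma tendsto_flow {ι : Type*} {F : Filter ι} {t : ι → ℝ} {v : ι → S.Control}
    {x : ι → Fin (d + 1) → ℝ} {t₀ : ℝ} {u : S.Control} {y : Fin (d + 1) → ℝ}
    (ht : Tendsto t F (𝓝 t₀)) (hv : Tendsto v F (𝓝 u)) (hx : Tendsto x F (𝓝 y)) :
    Tendsto (fun i => flow (v i) (t i) (x i)) F (𝓝 (flow u t₀ y)) := by
  have h := ((continuous_flow (S := S)).tendsto (t₀, u, y)).comp
    (ht.prodMk_nhds (hv.prodMk_nhds hx))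
  simpa only [Function.comp_def] using h

lemma isContinuousFlow_controlFlow [T2Space (RealProjectiveSpace d)] :
    IsContinuousFlow S.controlFlow where
  continuous := by
    rw [continuous_iff_ultrafilter]
    rintro ⟨t, u, p⟩ F hF
    have ht : Tendsto (fun q : ℝ × S.Control × RealProjectiveSpace d => q.1) F (𝓝 t) :=
      (continuous_fst.tendsto _).mono_left hF
    have hu : Tendsto (fun q : ℝ × S.Control × RealProjectiveSpace d => q.2.1) F (𝓝 u) :=
      ((continuous_fst.comp continuous_snd).tendsto _).mono_left hF
    have hp : Tendsto (fun q : ℝ × S.Control × RealProjectiveSpace d => q.2.2) F (𝓝 p) :=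
      ((continuous_snd.comp continuous_snd).tendsto _).mono_left hF
    choose x hx hxp using exists_unit_rep (d := d)
    obtain ⟨y, hy, hxy⟩ := exists_tendsto_unit F
      (x := fun q : ℝ × S.Control × RealProjectiveSpace d => x q.2.2) fun q => hx _
    -- The chosen unit representatives need not depend continuously on the point, but their limit
    -- along the ultrafilter represents `p` because the projective space is Hausdorff.
    have hpy : p = Projectivization.mk ℝ y (unit_ne_zero hy) := by
      refine tendsto_nhds_unique hp ?_
      have := tendsto_projMk (fun q => unit_ne_zero (hx _)) (unit_ne_zero hy) hxy
      simpa only [← hxp] using this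
    have h1 : ∀ q : ℝ × S.Control × RealProjectiveSpace d, S.controlFlow q.1 q.2 =
        (shift q.1 q.2.1, Projectivization.mk ℝ (flow q.2.1 q.1 (x q.2.2))
          (flow_ne_zero _ _ (unit_ne_zero (hx _)))) := by
      intro q
      rw [← controlFlow_mk _ _ _ (unit_ne_zero (hx _)), ← hxp]
    simp only [h1, hpy, controlFlow_mk]
    refine Tendsto.prodMk_nhds ?_ (tendsto_projMk _ _ (tendsto_flow ht hu hxy))
    exact (continuous_shift.tendsto (t, u)).comp (ht.prodMk_nhds hu)
  map_zero := by
    rintro ⟨u, p⟩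
    induction p using Projectivization.ind with
    | h x hx => simp only [controlFlow_mk, shift_zero, flow_zero]
  map_add := by
    rintro s t ⟨u, p⟩
    induction p using Projectivization.ind with
    | h x hx => simp only [controlFlow_mk, shift_add, flow_cocycle]

/-! ### Fibers of attractors and repellers -/

/-- An invariant closed set whose complement is attracted, along `l`, by a disjoint closed set `R`
does not contain the end points of a projective segment whose interior avoids it. -/
lemma false_of_segment {A R : Set (S.Control × RealProjectiveSpace d)} {l : Filter ℝ} [l.NeBot]
    (hA : IsClosed A) (hR : IsClosed R) (hAR : Disjoint A R)
    (hinv : ∀ t, ∀ y ∈ A, S.controlFlow t y ∈ A)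
    (hlim : ∀ y z, y ∉ A → MapClusterPt z l (fun t => S.controlFlow t y) → z ∈ R)
    {u : S.Control} {e f : Fin (d + 1) → ℝ} (he : e ≠ 0) (hf : f ≠ 0)
    (heA : (u, Projectivization.mk ℝ e he) ∈ A) (hfA : (u, Projectivization.mk ℝ f hf) ∈ A)
    (h0 : ∀ c : ℝ, 0 < c → e + c • f ≠ 0)
    (h : ∀ (c : ℝ) (hc : 0 < c), (u, Projectivization.mk ℝ (e + c • f) (h0 c hc)) ∉ A) :
    False := by
  have hFl : ((Ultrafilter.of l : Ultrafilter ℝ) : Filter ℝ) ≤ l := Ultrafilter.of_le l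
  generalize Ultrafilter.of l = F at hFl
  -- By the symmetry exchanging `e` with `f` and `c` with `c⁻¹`, the vector `e` may be assumed to
  -- dominate along the ultrafilter.
  wlog hle : ∀ᶠ t in (F : Filter ℝ), ‖flow u t f‖ ≤ ‖flow u t e‖ generalizing e f
  · have h0' : ∀ c : ℝ, 0 < c → f + c • e = c • (e + c⁻¹ • f) := by
      intro c hc
      rw [smul_add, smul_inv_smul₀ hc.ne']
      exact add_comm _ _
    have h0'' : ∀ c : ℝ, 0 < c → f + c • e ≠ 0 := fun c hc => by
      rw [h0' c hc]
      exact smul_ne_zero hc.ne' (h0 _ (inv_pos.mpr hc))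
    refine this hf he hfA heA h0'' (fun c hc => ?_) ?_
    · rw [projMk_eq_of_smul (h0'' c hc) (h0 _ (inv_pos.mpr hc)) (h0' c hc)]
      exact h _ (inv_pos.mpr hc)
    · rw [← Ultrafilter.eventually_not] at hle
      filter_upwards [hle] with t ht using (not_le.mp ht).le
  have hne : ∀ t, ‖flow u t e‖ ≠ 0 := fun t => norm_ne_zero_iff.mpr (flow_ne_zero u t he)
  have hnf : ∀ t, ‖flow u t f‖ ≠ 0 := fun t => norm_ne_zero_iff.mpr (flow_ne_zero u t hf)
  obtain ⟨v, -, hv⟩ := isCompact_univ.ultrafilter_le_nhds (F.map fun t => shift t u)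
    (by simp)
  replace hv : Tendsto (fun t => shift t u) F (𝓝 v) := hv
  have hg1 : ∀ t, ‖‖flow u t e‖⁻¹ • flow u t e‖ = 1 := fun t =>
    norm_smul_inv_norm (flow_ne_zero u t he)
  have hk1 : ∀ t, ‖‖flow u t f‖⁻¹ • flow u t f‖ = 1 := fun t =>
    norm_smul_inv_norm (flow_ne_zero u t hf)
  obtain ⟨g, hg, hgt⟩ := exists_tendsto_unit F hg1
  obtain ⟨k, hk, hkt⟩ := exists_tendsto_unit F hk1
  obtain ⟨ρ, hρ, hρt⟩ := (isCompact_Icc (a := (0 : ℝ)) (b := 1)).ultrafilter_le_nhds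
    (F.map fun t => ‖flow u t f‖ / ‖flow u t e‖) (by
      rw [Ultrafilter.coe_map, le_principal_iff, mem_map]
      filter_upwards [hle] with t ht
      exact ⟨by positivity, div_le_one_of_le₀ ht (norm_nonneg _)⟩)
  replace hρt : Tendsto (fun t => ‖flow u t f‖ / ‖flow u t e‖) F (𝓝 ρ) := hρt
  have hgA : (v, Projectivization.mk ℝ g (unit_ne_zero hg)) ∈ A := by
    refine hA.mem_of_tendsto (hv.prodMk_nhds (tendsto_projMk (fun t => unit_ne_zero (hg1 t))
      (unit_ne_zero hg) hgt)) (Eventually.of_forall fun t => ?_)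
    rw [projMk_eq_of_smul (unit_ne_zero (hg1 t)) (flow_ne_zero u t he) rfl, ← controlFlow_mk _ _ _ he]
    exact hinv t _ heA
  -- Here `g` and `k` are unit vectors and `ρ ≤ 1`, so `c < 1` excludes cancellation in the limit
  -- vector.
  have hnz : ∀ c ∈ Ioo (0 : ℝ) 1, g + (c * ρ) • k ≠ 0 := by
    intro c hc h0
    have h1 : ‖g‖ = ‖(c * ρ) • k‖ := by rw [eq_neg_of_add_eq_zero_left h0, norm_neg]
    rw [hg, norm_smul, hk, mul_one, Real.norm_eq_abs,
      abs_of_nonneg (mul_nonneg hc.1.le hρ.1)] at h1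
    nlinarith [hc.1, hc.2, hρ.1, hρ.2]
  have hcR : ∀ c (hc : c ∈ Ioo (0 : ℝ) 1),
      (v, Projectivization.mk ℝ (g + (c * ρ) • k) (hnz c hc)) ∈ R := by
    intro c hc
    refine hlim _ _ (h c hc.1) (MapClusterPt.mono (F := F) ?_ hFl)
    refine Tendsto.mapClusterPt ?_
    have e1 : ∀ t, ‖flow u t e‖⁻¹ • flow u t (e + c • f) = ‖flow u t e‖⁻¹ • flow u t e +
        (c * (‖flow u t f‖ / ‖flow u t e‖)) • ‖flow u t f‖⁻¹ • flow u t f := by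
      intro t
      rw [flow_add, flow_smul, smul_add, smul_smul, smul_smul]
      congr 2
      field_simp [hne t, hnf t]
    have hnz' : ∀ t, ‖flow u t e‖⁻¹ • flow u t (e + c • f) ≠ 0 := fun t =>
      smul_ne_zero (inv_ne_zero (hne t)) (flow_ne_zero u t (h0 c hc.1))
    have e2 : ∀ t, S.controlFlow t (u, Projectivization.mk ℝ (e + c • f) (h0 c hc.1)) =
        (shift t u, Projectivization.mk ℝ _ (hnz' t)) := by
      intro t
      rw [controlFlow_mk, projMk_eq_of_smul (hnz' t) (flow_ne_zero u t (h0 c hc.1)) rfl]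
    simp only [e2]
    refine hv.prodMk_nhds (tendsto_projMk _ _ ?_)
    simp only [e1]
    exact hgt.add ((hρt.const_mul c).smul hkt)
  -- Letting `c → 0` in `hcR` puts the limit `g` of the end point `e` into `R`, whereas invariance
  -- and closedness put it into `A`.
  have hgR : (v, Projectivization.mk ℝ g (unit_ne_zero hg)) ∈ R := by
    have hcn : ∀ n : ℕ, (1 / ((n : ℝ) + 2)) ∈ Ioo (0 : ℝ) 1 := fun n => by
      refine ⟨by positivity, ?_⟩
      rw [div_lt_one (by positivity)]
      linarith [n.cast_nonneg (α := ℝ)]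
    refine hR.mem_of_tendsto (b := (atTop : Filter ℕ)) (tendsto_const_nhds.prodMk_nhds (tendsto_projMk
      (fun n => hnz _ (hcn n)) (unit_ne_zero hg) ?_)) (Eventually.of_forall fun n => hcR _ (hcn n))
    have h1 : Tendsto (fun n : ℕ => 1 / ((n : ℝ) + 2)) atTop (𝓝 0) := by
      have := (tendsto_add_atTop_iff_nat 1).mpr (tendsto_one_div_add_atTop_nhds_zero_nat (𝕜 := ℝ))
      refine this.congr fun n => ?_
      push_cast
      ring
    have h2 := tendsto_const_nhds (x := g) |>.add ((h1.mul_const ρ).smul_const k)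
    simpa using h2
  exact Set.disjoint_left.mp hAR hgA hgR

lemma add_mem_of_mem {A R : Set (S.Control × RealProjectiveSpace d)} {l : Filter ℝ} [l.NeBot]
    (hA : IsClosed A) (hR : IsClosed R) (hAR : Disjoint A R)
    (hinv : ∀ t, ∀ y ∈ A, S.controlFlow t y ∈ A)
    (hlim : ∀ y z, y ∉ A → MapClusterPt z l (fun t => S.controlFlow t y) → z ∈ R)
    {u : S.Control} {x y : Fin (d + 1) → ℝ} (hx : x ≠ 0) (hy : y ≠ 0) (hxy : x + y ≠ 0)
    (hxA : (u, Projectivization.mk ℝ x hx) ∈ A) (hyA : (u, Projectivization.mk ℝ y hy) ∈ A) :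
    (u, Projectivization.mk ℝ (x + y) hxy) ∈ A := by
  by_contra hnot
  by_cases hdep : ∃ c : ℝ, y = c • x
  · obtain ⟨c, hc⟩ := hdep
    refine hnot ?_
    rwa [projMk_eq_of_smul hxy hx (c := 1 + c) (by rw [hc]; module)]
  have hline : ∀ a b : ℝ, a • x + b • y = 0 → a = 0 ∧ b = 0 := by
    intro a b hab
    have hb : b = 0 := by
      by_contra hb
      refine hdep ⟨-(b⁻¹ * a), ?_⟩
      have : b⁻¹ • (a • x + b • y) = 0 := by rw [hab, smul_zero]
      rw [smul_add, smul_smul, inv_smul_smul₀ hb] at this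
      rw [neg_smul]
      exact eq_neg_of_add_eq_zero_right this
    rw [hb, zero_smul, add_zero] at hab
    exact ⟨(smul_eq_zero.mp hab).resolve_right hx, hb⟩
  let f : ℝ → Fin (d + 1) → ℝ := fun s => (1 - s) • x + s • y
  have hf0 : ∀ s, f s ≠ 0 := fun s hs => by
    have := hline _ _ hs
    linarith [this.1, this.2]
  have hfc : Continuous f := by fun_prop
  -- If `x + y` were not in the fiber, the closed set `K` would have a gap around `1 / 2`. The end
  -- points `a < b` of that gap span a segment excluded by `false_of_segment`.
  let K : Set ℝ := {s | (u, Projectivization.mk ℝ (f s) (hf0 s)) ∈ A}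
  have hK : IsClosed K := by
    refine hA.preimage (continuous_iff_continuousAt.mpr fun s => ?_)
    exact tendsto_const_nhds.prodMk_nhds (tendsto_projMk _ _ (hfc.tendsto s))
  have h0K : (0 : ℝ) ∈ K := by
    change (u, _) ∈ A
    rwa [projMk_eq_of_smul (hf0 0) hx (c := 1) (by simp [f])]
  have h1K : (1 : ℝ) ∈ K := by
    change (u, _) ∈ A
    rwa [projMk_eq_of_smul (hf0 1) hy (c := 1) (by simp [f])]
  have hhalf : (1 / 2 : ℝ) ∉ K := by
    intro hs
    refine hnot ?_
    rwa [projMk_eq_of_smul hxy (hf0 (1 / 2)) (c := 2) (by simp only [f]; module)]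
  obtain ⟨a, ⟨haK, ha⟩, hamax⟩ := ((isCompact_Icc (a := (0 : ℝ)) (b := 1 / 2)).inter_left
    hK).exists_isGreatest ⟨0, h0K, by norm_num⟩
  obtain ⟨b, ⟨hbK, hb⟩, hbmin⟩ := ((isCompact_Icc (a := (1 / 2 : ℝ)) (b := 1)).inter_left
    hK).exists_isLeast ⟨1, h1K, by norm_num⟩
  have hab : a < b := by
    refine lt_of_le_of_ne (ha.2.trans hb.1) fun hab => hhalf ?_
    have : a = 1 / 2 := le_antisymm ha.2 (hab ▸ hb.1)
    exact this ▸ haK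
  have hmid : ∀ s, a < s → s < b → s ∉ K := by
    intro s has hsb hs
    rcases le_total s (1 / 2) with h | h
    · exact has.not_ge (hamax ⟨hs, ha.1.trans has.le, h⟩)
    · exact hsb.not_ge (hbmin ⟨hs, h, hsb.le.trans hb.2⟩)
  have hcomb : ∀ c : ℝ, 0 < c → f a + c • f b = (1 + c) • f ((a + c * b) / (1 + c)) := by
    intro c hc
    have hs : (1 + c) * ((a + c * b) / (1 + c)) = a + c * b := mul_div_cancel₀ _ (by positivity)
    generalize (a + c * b) / (1 + c) = s at hs
    have e : (1 + c) • f s = (1 + c - (1 + c) * s) • x + ((1 + c) * s) • y := by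
      simp only [f]
      module
    rw [e, hs]
    simp only [f]
    module
  have hcomb0 : ∀ c : ℝ, 0 < c → f a + c • f b ≠ 0 := by
    intro c hc
    rw [hcomb c hc]
    exact smul_ne_zero (by positivity) (hf0 _)
  refine false_of_segment hA hR hAR hinv hlim (hf0 a) (hf0 b) haK hbK hcomb0 fun c hc hcA => ?_
  rw [projMk_eq_of_smul (hcomb0 c hc) (hf0 _) (hcomb c hc)] at hcA
  have hc' : 0 < 1 + c := by positivity
  refine hmid _ ?_ ?_ hcA
  · rw [lt_div_iff₀ hc']
    nlinarith
  · rw [div_lt_iff₀ hc']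
    nlinarith

/-- The linear subspaces `W u` are the fibers of `A`. -/
def HasLinearFibers (A : Set (S.Control × RealProjectiveSpace d))
    (W : S.Control → Submodule ℝ (Fin (d + 1) → ℝ)) : Prop :=
  ∀ u x (hx : x ≠ 0), x ∈ W u ↔ (u, Projectivization.mk ℝ x hx) ∈ A

lemma exists_hasLinearFibers {A R : Set (S.Control × RealProjectiveSpace d)} {l : Filter ℝ}
    [l.NeBot] (hA : IsClosed A) (hR : IsClosed R) (hAR : Disjoint A R)
    (hinv : ∀ t, ∀ y ∈ A, S.controlFlow t y ∈ A)
    (hlim : ∀ y z, y ∉ A → MapClusterPt z l (fun t => S.controlFlow t y) → z ∈ R) :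
    ∃ W, HasLinearFibers A W := by
  refine ⟨fun u =>
    { carrier := {x | ∀ hx : x ≠ 0, (u, Projectivization.mk ℝ x hx) ∈ A}
      zero_mem' := fun hx => absurd rfl hx
      add_mem' := ?_
      smul_mem' := ?_ }, fun u x hx => ⟨fun h => h hx, fun h _ => h⟩⟩
  · intro x y hx hy hxy
    by_cases hx0 : x = 0
    · subst hx0
      simp only [zero_add] at hxy ⊢
      exact hy hxy
    by_cases hy0 : y = 0
    · subst hy0
      simp only [add_zero] at hxy ⊢
      exact hx hxy
    exact add_mem_of_mem hA hR hAR hinv hlim hx0 hy0 hxy (hx hx0) (hy hy0)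
  · intro c x hx hcx
    have hx0 : x ≠ 0 := right_ne_zero_of_smul hcx
    rw [projMk_eq_of_smul hcx hx0 rfl]
    exact hx hx0

lemma mapClusterPt_prod_of_mapClusterPt {Y : Type*} [TopologicalSpace Y] {Φ : ℝ → Y → Y} {y z : Y}
    {l : Filter ℝ} (h : MapClusterPt z l fun t => Φ t y) :
    MapClusterPt z (𝓝 y ×ˢ l) fun p => Φ p.2 p.1 :=
  MapClusterPt.of_comp (φ := fun t => (y, t)) ((tendsto_const_nhds (x := y)).prodMk tendsto_id) h

lemma _root_.IsAttractorRepellerPair.exists_left {A R : Set (S.Control × RealProjectiveSpace d)}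
    (h : IsAttractorRepellerPair S.controlFlow A R) : ∃ W, HasLinearFibers A W :=
  exists_hasLinearFibers (l := atBot) h.isClosed_left h.isClosed_right h.disjoint h.map_left
    fun y z hy hz => h.backward y z hy (mapClusterPt_prod_of_mapClusterPt hz)

lemma _root_.IsAttractorRepellerPair.exists_right {A R : Set (S.Control × RealProjectiveSpace d)}
    (h : IsAttractorRepellerPair S.controlFlow A R) : ∃ W, HasLinearFibers R W :=
  exists_hasLinearFibers (l := atTop) h.isClosed_right h.isClosed_left h.disjoint.symm h.map_right
    fun y z hy hz => h.forward y z hy (mapClusterPt_prod_of_mapClusterPt hz)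

/-- Concatenations of `u` and `v` converge to `u` and, shifted, to `v`. -/
lemma exists_connecting_controls (u v : S.Control) : ∃ w : ℕ → S.Control,
    Tendsto w atTop (𝓝 u) ∧ Tendsto (fun n : ℕ => shift (2 * n) (w n)) atTop (𝓝 v) := by
  -- The `n`-th control is `u` before time `n` and `v(· - 2n)` afterwards, so its shift by `2n`
  -- agrees with `v` on `[-n, ∞)`.
  refine ⟨fun n => concat n u (shift (-n) v), ?_, ?_⟩
  · refine tendsto_of_agreeOn fun a b => ?_
    obtain ⟨N, hN⟩ := exists_nat_gt b
    filter_upwards [eventually_ge_atTop N] with n hn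
    refine (concat_agreeOn_Iio _ _ _).mono fun s hs => ?_
    exact hs.2.trans_lt (hN.trans_le (by exact_mod_cast hn))
  · refine tendsto_of_agreeOn fun a b => ?_
    obtain ⟨N, hN⟩ := exists_nat_gt (-a)
    filter_upwards [eventually_ge_atTop N] with n hn
    have hn' : (N : ℝ) ≤ n := by exact_mod_cast hn
    have h := (shift_concat_agreeOn n u (shift (-n) v)).shift n
    rw [← shift_add, ← shift_add, add_neg_cancel, shift_zero, ← two_mul] at h
    refine h.mono fun s hs => ?_
    have := hs.1
    change 0 ≤ s + n
    linarith

/-- A subspace that avoids the repeller over `u` is driven, along the connecting controls, into the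
attractor over `v`. Were its dimension larger than that of `W v`, its images would all meet a fixed
complement `Z` of `W v`, and a limit of unit vectors in these intersections would lie in both `W v`
and `Z`. -/
lemma _root_.IsAttractorRepellerPair.finrank_le {A R : Set (S.Control × RealProjectiveSpace d)}
    (h : IsAttractorRepellerPair S.controlFlow A R)
    {W : S.Control → Submodule ℝ (Fin (d + 1) → ℝ)} (hW : HasLinearFibers A W) (u v : S.Control)
    (C : Submodule ℝ (Fin (d + 1) → ℝ))
    (hC : ∀ x ∈ C, ∀ hx : x ≠ 0, (u, Projectivization.mk ℝ x hx) ∉ R) :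
    Module.finrank ℝ C ≤ Module.finrank ℝ (W v) := by
  by_contra! hlt
  obtain ⟨Z, hZ⟩ := Submodule.exists_isCompl (W v)
  obtain ⟨w, hwu, hwv⟩ := exists_connecting_controls u v
  have hex : ∀ n : ℕ, ∃ x ∈ C, ‖x‖ = 1 ∧ flow (w n) (2 * n) x ∈ Z := by
    intro n
    have hdim := Submodule.finrank_add_eq_of_isCompl hZ
    have hmap : Module.finrank ℝ (C.map (flowEquiv (w n) (2 * n)).toLinearMap) =
        Module.finrank ℝ C := LinearEquiv.finrank_map_eq _ _
    have hsup := Submodule.finrank_sup_add_finrank_inf_eq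
      (C.map (flowEquiv (w n) (2 * n)).toLinearMap) Z
    have hle := Submodule.finrank_le (C.map (flowEquiv (w n) (2 * n)).toLinearMap ⊔ Z)
    have hne : C.map (flowEquiv (w n) (2 * n)).toLinearMap ⊓ Z ≠ ⊥ := by
      intro hbot
      rw [hbot, finrank_bot] at hsup
      omega
    obtain ⟨z, ⟨⟨x, hx, rfl⟩, hz⟩, hz0⟩ := Submodule.exists_mem_ne_zero_of_ne_bot hne
    have hx0 : x ≠ 0 := by
      rintro rfl
      simp at hz0
    refine ⟨‖x‖⁻¹ • x, C.smul_mem _ hx, norm_smul_inv_norm hx0, ?_⟩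
    rw [flow_smul]
    exact Z.smul_mem _ hz
  choose x hxC hx1 hxZ using hex
  have hz1 : ∀ n : ℕ, ‖‖flow (w n) (2 * n) (x n)‖⁻¹ • flow (w n) (2 * n) (x n)‖ = 1 := fun n =>
    norm_smul_inv_norm (flow_ne_zero _ _ (unit_ne_zero (hx1 n)))
  obtain ⟨y, hy1, hy⟩ := exists_tendsto_unit (hyperfilter ℕ) hx1
  obtain ⟨z, hz1', hz⟩ := exists_tendsto_unit (hyperfilter ℕ) hz1
  have hle : (hyperfilter ℕ : Filter ℕ) ≤ atTop := Nat.hyperfilter_le_atTop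
  have hyC : y ∈ C := C.closed_of_finiteDimensional.mem_of_tendsto hy (Eventually.of_forall hxC)
  have hzZ : z ∈ Z := Z.closed_of_finiteDimensional.mem_of_tendsto hz
    (Eventually.of_forall fun n => Z.smul_mem _ (hxZ n))
  have hzA : (v, Projectivization.mk ℝ z (unit_ne_zero hz1')) ∈ A := by
    refine h.forward _ _ (hC y hyC (unit_ne_zero hy1)) ?_
    refine MapClusterPt.of_comp (p := (hyperfilter ℕ : Filter ℕ))
      (φ := fun n : ℕ => ((w n, Projectivization.mk ℝ (x n) (unit_ne_zero (hx1 n))),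
        (2 * n : ℝ))) ?_ (Tendsto.mapClusterPt ?_)
    · refine Tendsto.prodMk ?_ ?_
      · exact (hwu.mono_left hle).prodMk_nhds (tendsto_projMk _ _ hy)
      · exact (tendsto_natCast_atTop_atTop.const_mul_atTop (by norm_num)).mono_left hle
    · have e : ∀ n : ℕ, S.controlFlow (2 * n) (w n, Projectivization.mk ℝ (x n)
          (unit_ne_zero (hx1 n))) = (shift (2 * n) (w n),
            Projectivization.mk ℝ _ (unit_ne_zero (hz1 n))) := by
        intro n
        rw [controlFlow_mk, projMk_eq_of_smul (unit_ne_zero (hz1 n))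
          (flow_ne_zero _ _ (unit_ne_zero (hx1 n))) rfl]
      simp only [Function.comp_def, e]
      exact (hwv.mono_left hle).prodMk_nhds (tendsto_projMk _ _ hz)
  have hzW : z ∈ W v := (hW v z (unit_ne_zero hz1')).mpr hzA
  exact unit_ne_zero hz1' (Submodule.disjoint_def.mp hZ.disjoint z hzW hzZ)

/-- The fibers of an attractor and its complementary repeller have constant and complementary
dimensions. -/
lemma _root_.IsAttractorRepellerPair.finrank_add {A R : Set (S.Control × RealProjectiveSpace d)}
    (h : IsAttractorRepellerPair S.controlFlow A R)
    {W V : S.Control → Submodule ℝ (Fin (d + 1) → ℝ)} (hW : HasLinearFibers A W)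
    (hV : HasLinearFibers R V) (u v : S.Control) :
    Module.finrank ℝ (W u) + Module.finrank ℝ (V v) = d + 1 := by
  -- The lower bound holds for all pairs of controls and the upper bound only on the diagonal. The
  -- bounds for `(u, v)` and `(v, u)` together then force equality.
  have hge : ∀ u v, d + 1 ≤ Module.finrank ℝ (W u) + Module.finrank ℝ (V v) := by
    intro u v
    obtain ⟨C, hC⟩ := Submodule.exists_isCompl (V v)
    have h1 := h.finrank_le hW v u C fun x hx hx0 hxR =>
      hx0 (Submodule.disjoint_def.mp hC.disjoint x ((hV v x hx0).mpr hxR) hx)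
    have h2 := Submodule.finrank_add_eq_of_isCompl hC
    rw [Module.finrank_fin_fun] at h2
    omega
  have hle : ∀ u, Module.finrank ℝ (W u) + Module.finrank ℝ (V u) ≤ d + 1 := by
    intro u
    have hd : W u ⊓ V u = ⊥ := by
      rw [eq_bot_iff]
      rintro x ⟨h1, h2⟩
      by_contra hx
      exact Set.disjoint_left.mp h.disjoint ((hW u x hx).mp h1) ((hV u x hx).mp h2)
    have h1 := Submodule.finrank_sup_add_finrank_inf_eq (W u) (V u)
    have h2 := Submodule.finrank_le (W u ⊔ V u)
    rw [hd, finrank_bot] at h1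
    rw [Module.finrank_fin_fun] at h2
    omega
  have h1 := hge u v
  have h2 := hge v u
  have h3 := hle u
  have h4 := hle v
  omega

lemma HasLinearFibers.mono {A B : Set (S.Control × RealProjectiveSpace d)}
    {W V : S.Control → Submodule ℝ (Fin (d + 1) → ℝ)} (hW : HasLinearFibers A W)
    (hV : HasLinearFibers B V) (h : A ⊆ B) (u : S.Control) : W u ≤ V u := by
  intro x hx
  by_cases hx0 : x = 0
  · rw [hx0]; exact zero_mem _
  · exact (hV u x hx0).mpr (h ((hW u x hx0).mp hx))

lemma HasLinearFibers.subset {A B : Set (S.Control × RealProjectiveSpace d)}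
    {W V : S.Control → Submodule ℝ (Fin (d + 1) → ℝ)} (hW : HasLinearFibers A W)
    (hV : HasLinearFibers B V) (h : ∀ u, W u ≤ V u) : A ⊆ B := by
  rintro ⟨u, p⟩ hp
  induction p using Projectivization.ind with
  | h x hx => exact (hV u x hx).mp (h u ((hW u x hx).mpr hp))

/-- A decreasing sequence of sets with linear fibers of constant dimension is eventually
constant. -/
lemma exists_eq_iInter {A : ℕ → Set (S.Control × RealProjectiveSpace d)}
    {W : ℕ → S.Control → Submodule ℝ (Fin (d + 1) → ℝ)} (hW : ∀ n, HasLinearFibers (A n) (W n))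
    (hdim : ∀ n u v, Module.finrank ℝ (W n u) = Module.finrank ℝ (W n v)) (hA : Antitone A) :
    ∃ n, ⋂ k, A k = A n := by
  rcases isEmpty_or_nonempty S.Control with hS | ⟨⟨u₀⟩⟩
  · exact ⟨0, Subsingleton.elim _ _⟩
  -- The sequence is stationary from an index at which the fiber dimension is minimal.
  obtain ⟨n, hn⟩ : ∃ n, ∀ k, Module.finrank ℝ (W n u₀) ≤ Module.finrank ℝ (W k u₀) := by
    obtain ⟨n, hn⟩ := WellFounded.has_min (measure fun k => Module.finrank ℝ (W k u₀)).wf univ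
      ⟨0, mem_univ _⟩
    exact ⟨n, fun k => not_lt.mp (hn.2 k (mem_univ k))⟩
  refine ⟨n, subset_antisymm (iInter_subset A n) (subset_iInter fun k => ?_)⟩
  refine Subset.trans ?_ (hA (le_max_left k n))
  refine (hW n).subset (hW _) fun u => ?_
  refine (Submodule.eq_of_le_of_finrank_le
    ((hW (max k n)).mono (hW n) (hA (le_max_right k n)) u) ?_).ge
  rw [hdim n u u₀, hdim _ u u₀]
  exact hn _

/-- The intersection `L` of an attractor `A` and a repeller `R` is, if nonempty, a subbundle: its
fibers have constant dimension. -/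
lemma finrank_inf_eq {A A' B R : Set (S.Control × RealProjectiveSpace d)}
    (hA : IsAttractorRepellerPair S.controlFlow A A')
    (hR : IsAttractorRepellerPair S.controlFlow B R) (hne : (A ∩ R).Nonempty)
    {W V : S.Control → Submodule ℝ (Fin (d + 1) → ℝ)} (hW : HasLinearFibers A W)
    (hV : HasLinearFibers R V) (u v : S.Control) :
    Module.finrank ℝ (W u ⊓ V u : Submodule ℝ (Fin (d + 1) → ℝ)) =
      Module.finrank ℝ (W v ⊓ V v : Submodule ℝ (Fin (d + 1) → ℝ)) := by
  obtain ⟨W', hW'⟩ := hA.exists_right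
  obtain ⟨V', hV'⟩ := hR.exists_left
  -- The union of the attractors `A` and `B` is an attractor, so its fibers are linear too.
  obtain ⟨X, hX⟩ := (hA.union hR).exists_left
  have hAd := hA.finrank_add hW hW'
  have hBd := hR.finrank_add hV' hV
  have hWX : ∀ u, W u ≤ X u := hW.mono hX subset_union_left
  have hVX : ∀ u, V' u ≤ X u := hV'.mono hX subset_union_right
  -- The subspace `X u` is the union of the subspaces `W u` and `V' u`, so one of them contains the
  -- other.
  have hdich : ∀ u, V' u ≤ W u ∨ W u ≤ V' u := by
    intro u
    by_contra! hcon
    obtain ⟨⟨x, hxV, hxW⟩, ⟨y, hyW, hyV⟩⟩ :=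
      And.imp SetLike.not_le_iff_exists.mp SetLike.not_le_iff_exists.mp hcon
    have hxy : x + y ∈ X u := add_mem (hVX u hxV) (hWX u hyW)
    have hxy0 : x + y ≠ 0 := by
      intro h0
      rw [eq_neg_of_add_eq_zero_left h0] at hxW
      exact hxW (neg_mem hyW)
    rcases (hX u _ hxy0).mp hxy with h1 | h1
    · exact hxW ((Submodule.add_mem_iff_left _ hyW).mp ((hW u _ hxy0).mpr h1))
    · exact hyV ((Submodule.add_mem_iff_right _ hxV).mp ((hV' u _ hxy0).mpr h1))
  -- Otherwise `A ⊆ B`, and `A ∩ R` would be empty. Because dimensions are constant, one control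
  -- `u₁` where the inclusion fails settles the nesting for all controls.
  have hlt : ¬ ∀ u, W u ≤ V' u := by
    intro hall
    obtain ⟨q, hqA, hqR⟩ := hne
    exact Set.disjoint_left.mp hR.disjoint (hW.subset hV' hall hqA) hqR
  obtain ⟨u₁, hu₁⟩ := not_forall.mp hlt
  have hle : ∀ u, V' u ≤ W u := by
    intro u
    refine (hdich u).elim id fun h => ?_
    refine (Submodule.eq_of_le_of_finrank_le h ?_).ge
    have h1 := Submodule.finrank_mono ((hdich u₁).resolve_right hu₁)
    have h2 := hAd u u
    have h3 := hAd u₁ u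
    have h4 := hBd u u
    have h5 := hBd u₁ u
    omega
  -- Already `V' u` and `V u` span, so `W u` and `V u` are transversal and their intersection has
  -- dimension `dim W u + dim V u - (d + 1)`.
  have hsup : ∀ u, Module.finrank ℝ (W u ⊔ V u : Submodule ℝ (Fin (d + 1) → ℝ)) = d + 1 := by
    intro u
    have hd : V' u ⊓ V u = ⊥ := by
      rw [eq_bot_iff]
      rintro x ⟨h1, h2⟩
      by_contra hx
      exact Set.disjoint_left.mp hR.disjoint ((hV' u x hx).mp h1) ((hV u x hx).mp h2)
    have h1 := Submodule.finrank_sup_add_finrank_inf_eq (V' u) (V u)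
    have h2 := Submodule.finrank_le (W u ⊔ V u)
    have h3 := Submodule.finrank_mono (sup_le_sup_right (hle u) (V u))
    rw [hd, finrank_bot] at h1
    rw [Module.finrank_fin_fun] at h2
    have := hBd u u
    omega
  have h1 := Submodule.finrank_sup_add_finrank_inf_eq (W u) (V u)
  have h2 := Submodule.finrank_sup_add_finrank_inf_eq (W v) (V v)
  rw [hsup] at h1 h2
  have h3 := hAd u u
  have h4 := hAd v u
  have h5 := hBd u u
  have h6 := hBd u v
  omega

end BilinearSystem

/-! ### Passage to an arbitrary compatible metric -/

section Metric

variable {X ι : Type*} [TopologicalSpace X] {D : X → X → ℝ} {F : Filter ι} {f g : ι → X} {a b : X}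

lemma IsCompatibleMetric.tendsto (hD : IsCompatibleMetric D) (hf : Tendsto f F (𝓝 a))
    (hg : Tendsto g F (𝓝 b)) : Tendsto (fun i => D (f i) (g i)) F (𝓝 (D a b)) :=
  letI := hD.toMetricSpace
  hf.dist hg

lemma IsCompatibleMetric.eventually_lt (hD : IsCompatibleMetric D) (hf : Tendsto f F (𝓝 a))
    (hg : Tendsto g F (𝓝 a)) {ε : ℝ} (hε : 0 < ε) : ∀ᶠ i in F, D (f i) (g i) < ε :=
  (hD.tendsto hf hg).eventually_lt_const (by rwa [hD.dist_self])

lemma IsCompatibleMetric.t2Space (hD : IsCompatibleMetric D) : T2Space X :=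
  letI := hD.toMetricSpace
  inferInstance

lemma IsCompatibleMetric.exists_attractors [CompactSpace X] (hD : IsCompatibleMetric D)
    {Φ : ℝ → X → X} (hΦ : IsContinuousFlow Φ) (q : X) :
    ∃ A R : ℕ → Set X, (∀ n, IsAttractorRepellerPair Φ (A n) (R n)) ∧ Antitone A ∧
      {y | ChainReaches Φ D q y} = ⋂ n, A n :=
  letI := hD.toMetricSpace
  exists_attractors_chainReaches hΦ q

lemma IsCompatibleMetric.exists_repellers (hD : IsCompatibleMetric D)
    {Φ : ℝ → X → X} (hΦ : IsContinuousFlow Φ) (q : X) :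
    ∃ A R : ℕ → Set X, (∀ n, IsAttractorRepellerPair Φ (A n) (R n)) ∧ Antitone R ∧
      {y | ChainReaches Φ D y q} = ⋂ n, R n :=
  letI := hD.toMetricSpace
  exists_repellers_chainReaches hΦ q

end Metric

namespace BilinearSystem

variable {d m : ℕ} {S : BilinearSystem d m}
  {D : S.Control × RealProjectiveSpace d → S.Control × RealProjectiveSpace d → ℝ}

/-! ### Chains realised by prescribed controls -/

lemma exists_ultrafilter_tendsto {X : Type*} [TopologicalSpace X] [CompactSpace X] {ι : Type*}
    (F : Ultrafilter ι) (f : ι → X) : ∃ x, Tendsto f F (𝓝 x) := by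
  obtain ⟨x, -, hx⟩ := isCompact_univ.ultrafilter_le_nhds (F.map f) (by simp)
  exact ⟨x, hx⟩

/-- Points of projective space that are close with respect to some controls are close with
respect to all controls. -/
lemma exists_uniform_jump (hD : IsCompatibleMetric D) {ε : ℝ} (hε : 0 < ε) : ∃ δ > 0,
    ∀ (u v w : S.Control) (p q : RealProjectiveSpace d), D (u, p) (v, q) < δ →
      D (w, p) (w, q) < ε := by
  -- By compactness, counterexamples would accumulate at a pair at distance zero, so their
  -- projective components would have a common limit.
  by_contra! hcon
  choose u v w p q hlt hge using fun n : ℕ => hcon (1 / ((n : ℝ) + 1)) (by positivity)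
  obtain ⟨u', hu⟩ := exists_ultrafilter_tendsto (hyperfilter ℕ) u
  obtain ⟨v', hv⟩ := exists_ultrafilter_tendsto (hyperfilter ℕ) v
  obtain ⟨w', hw⟩ := exists_ultrafilter_tendsto (hyperfilter ℕ) w
  obtain ⟨p', hp⟩ := exists_ultrafilter_tendsto (hyperfilter ℕ) p
  obtain ⟨q', hq⟩ := exists_ultrafilter_tendsto (hyperfilter ℕ) q
  have h1 := hD.tendsto (hu.prodMk_nhds hp) (hv.prodMk_nhds hq)
  have h2 : D (u', p') (v', q') ≤ 0 :=
    le_of_tendsto_of_tendsto' h1 ((tendsto_one_div_add_atTop_nhds_zero_nat (𝕜 := ℝ)).mono_left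
      Nat.hyperfilter_le_atTop) fun n => (hlt n).le
  have h3 : 0 ≤ D (u', p') (v', q') := by
    have := hD.triangle (u', p') (v', q') (u', p')
    rw [hD.dist_self, hD.symm (v', q')] at this
    linarith
  have h4 := hD.eq_of_dist_eq_zero _ _ (le_antisymm h2 h3)
  have hpq : p' = q' := congrArg Prod.snd h4
  have h5 := hD.eventually_lt (hw.prodMk_nhds hp) (hw.prodMk_nhds (hpq ▸ hq)) hε
  obtain ⟨n, hn⟩ := h5.exists
  exact (hge n).not_gt hn

/-- In the weak-* topology what a control does outside a large bounded window hardly matters. This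
leaves room to steer in the far future or the far past at the cost of a small jump. -/
lemma exists_agreeOn_dist_lt (hD : IsCompatibleMetric D) (u : S.Control)
    (p : RealProjectiveSpace d) {ε : ℝ} (hε : 0 < ε) : ∃ R₀ : ℝ, ∀ R, R₀ ≤ R → ∀ w : S.Control,
      AgreeOn (Ioo (-R) R) w u → D (w, p) (u, p) < ε := by
  by_contra! hcon
  choose R hR w hw hge using fun n : ℕ => hcon n
  have hlim : Tendsto w atTop (𝓝 u) := by
    refine tendsto_of_agreeOn fun a b => ?_
    obtain ⟨N, hN⟩ := exists_nat_gt (max (-a) b)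
    filter_upwards [eventually_ge_atTop N] with n hn
    refine (hw n).mono fun s hs => ?_
    have h1 : (N : ℝ) ≤ n := by exact_mod_cast hn
    have h2 := hR n
    have h3 := le_max_left (-a) b
    have h4 := le_max_right (-a) b
    constructor <;> linarith [hs.1, hs.2]
  obtain ⟨n, hn⟩ := (hD.eventually_lt (hlim.prodMk_nhds (tendsto_const_nhds (x := p)))
    (tendsto_const_nhds (x := (u, p))) hε).exists
  exact (hge n).not_gt hn

lemma projFlow_congr {u v : S.Control} {t : ℝ} (ht : 0 ≤ t) (h : AgreeOn (Ico 0 t) u v)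
    (p : RealProjectiveSpace d) : projFlow u t p = projFlow v t p := by
  induction p using Projectivization.ind with
  | h x hx => simp only [projFlow_mk, flow_congr ht h]

/-- The jumps of a chain can be realized along the trajectory of one control, which can be
prescribed before the beginning and after the end of the chain. -/
lemma exists_controlled_chain {ε δ T : ℝ} (hT : 0 ≤ T)
    (hδ : ∀ (u v w : S.Control) (p q : RealProjectiveSpace d), D (u, p) (v, q) < δ →
      D (w, p) (w, q) < ε) (v : S.Control) {a b : S.Control × RealProjectiveSpace d}
    (h : HasChain S.controlFlow D δ T a b) :
    ∃ w, ∀ w', AgreeOn (Ici 0) w' w → ∃ z, AgreeOn (Ici 0) z v ∧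
      HasChain S.controlFlow D ε T (w', a.2) (z, b.2) := by
  -- The control component never jumps: the next control is `shift t w'` itself. The control `w` is
  -- built from the end of the chain backwards, prepending for each leg the piece of `a.1` used on
  -- `[0, t)`.
  have hstep : ∀ (t : ℝ), T ≤ t → ∀ (a b : S.Control × RealProjectiveSpace d),
      D (S.controlFlow t a) b < δ → ∀ w₀ w', AgreeOn (Ici 0) w' (concat t a.1 w₀) →
        AgreeOn (Ici 0) (shift t w') w₀ ∧
          D (S.controlFlow t (w', a.2)) (shift t w', b.2) < ε := by
    intro t ht a b hab w₀ w' hw'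
    have ht0 : 0 ≤ t := hT.trans ht
    constructor
    · refine AgreeOn.trans ((hw'.shift t).mono fun s hs => ?_) (shift_concat_agreeOn t a.1 w₀)
      exact add_nonneg hs ht0
    · have h1 : projFlow w' t a.2 = projFlow a.1 t a.2 :=
        projFlow_congr ht0 ((hw'.mono fun s hs => hs.1).trans
          ((concat_agreeOn_Iio t a.1 w₀).mono fun s hs => hs.2)) _
      rw [controlFlow, h1]
      exact hδ _ _ _ _ _ hab
  induction h using Relation.TransGen.head_induction_on with
  | @single a h =>
    obtain ⟨t, ht, hd⟩ := h
    refine ⟨concat t a.1 v, fun w' hw' => ?_⟩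
    obtain ⟨h1, h2⟩ := hstep t ht a b hd v w' hw'
    exact ⟨shift t w', h1, Relation.TransGen.single ⟨t, ht, h2⟩⟩
  | @head a c h _ ih =>
    obtain ⟨t, ht, hd⟩ := h
    obtain ⟨w₀, hw₀⟩ := ih
    refine ⟨concat t a.1 w₀, fun w' hw' => ?_⟩
    obtain ⟨h1, h2⟩ := hstep t ht a c hd w₀ w' hw'
    obtain ⟨z, hz, hz'⟩ := hw₀ _ h1
    exact ⟨z, hz, Relation.TransGen.head ⟨t, ht, h2⟩ hz'⟩

lemma projFlow_add [T2Space (RealProjectiveSpace d)] (u : S.Control) (s t : ℝ)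
    (p : RealProjectiveSpace d) : projFlow u (s + t) p = projFlow (shift t u) s (projFlow u t p) :=
  congrArg Prod.snd (isContinuousFlow_controlFlow.map_add s t (u, p))

/-- Orbits that stay in the projection of a chain transitive set are connected by chains. -/
lemma chainReaches_of_orbits (hD : IsCompatibleMetric D) [T2Space (RealProjectiveSpace d)]
    {L : Set (S.Control × RealProjectiveSpace d)}
    (hL : ∀ a ∈ L, ∀ b ∈ L, ChainReaches S.controlFlow D a b) {u v : S.Control}
    {x y : RealProjectiveSpace d} (hx : ∀ t, projFlow u t x ∈ Prod.snd '' L)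
    (hy : ∀ t, projFlow v t y ∈ Prod.snd '' L) :
    ChainReaches S.controlFlow D (u, x) (v, y) := by
  intro ε hε T hT
  obtain ⟨δ, hδ0, hδ⟩ := exists_uniform_jump hD hε
  obtain ⟨R₀, hR₀⟩ := exists_agreeOn_dist_lt hD (shift T u) (projFlow u T x) hε
  obtain ⟨R₁, hR₁⟩ := exists_agreeOn_dist_lt hD v y hε
  set R := max R₀ T with hR
  set R' := max R₁ T with hR'
  have hRT : T ≤ R := le_max_right _ _
  have hRT' : T ≤ R' := le_max_right _ _
  -- Only the projective components of `a` and `b` are tied to the two orbits; their controls may be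
  -- unrelated to `u` and `v`. The new chain follows `u` for time `T + R`, its one jump at time `T`
  -- planting the control needed later. It then imitates a chain from `a` to `b`, and finally
  -- follows `v` for time `R'` to `y`, where a last small jump corrects the control.
  obtain ⟨a, ha, hap⟩ := hx (R + T)
  obtain ⟨b, hb, hbq⟩ := hy (-R')
  obtain ⟨w, hw⟩ := exists_controlled_chain hT.le hδ (shift (-R') v) (hL a ha b hb δ hδ0 T hT)
  obtain ⟨z, hz, hchain⟩ := hw _ (shift_concat_agreeOn R (shift T u) w)
  have hleft : AgreeOn (Iio R) (concat R (shift T u) w) (shift T u) := concat_agreeOn_Iio _ _ _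
  have h1 : HasChain S.controlFlow D ε T (u, x) (concat R (shift T u) w, projFlow u T x) := by
    refine Relation.TransGen.single ⟨T, le_rfl, ?_⟩
    rw [hD.symm]
    exact hR₀ R (le_max_left _ _) _ (hleft.mono fun s hs => hs.2)
  have h2 : HasChain S.controlFlow D ε T (concat R (shift T u) w, projFlow u T x)
      (shift R (concat R (shift T u) w), a.2) := by
    refine Relation.TransGen.single ⟨R, hRT, ?_⟩
    rw [hap, projFlow_add, controlFlow]
    simp only [projFlow_congr (hT.le.trans hRT) (hleft.mono fun s hs => hs.2), hD.dist_self]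
    exact hε
  have h3 : HasChain S.controlFlow D ε T (z, b.2) (v, y) := by
    refine Relation.TransGen.single ⟨R', hRT', ?_⟩
    have hy' : projFlow z R' b.2 = y := by
      rw [projFlow_congr (hT.le.trans hRT') (hz.mono fun s hs => hs.1), hbq, ← projFlow_add,
        add_neg_cancel]
      exact congrArg Prod.snd (isContinuousFlow_controlFlow.map_zero (v, y))
    rw [controlFlow, hy']
    refine hR₁ R' (le_max_left _ _) _ ?_
    have h4 := hz.shift R'
    rw [← shift_add, add_neg_cancel, shift_zero] at h4
    refine h4.mono fun s hs => ?_
    have := hs.1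
    change 0 ≤ s + R'
    linarith
  exact Relation.TransGen.trans h1 (Relation.TransGen.trans h2 (Relation.TransGen.trans hchain h3))

/-! ### Subbundles -/

lemma HasLinearFibers.mem_iff {A : Set (S.Control × RealProjectiveSpace d)}
    {W : S.Control → Submodule ℝ (Fin (d + 1) → ℝ)} (hW : HasLinearFibers A W) (u : S.Control)
    (p : RealProjectiveSpace d) : (u, p) ∈ A ↔ p ∈ projectiveSubspace (W u) := by
  constructor
  · induction p using Projectivization.ind with
    | h x hx => exact fun h => ⟨x, hx, (hW u x hx).mpr h, rfl⟩
  · rintro ⟨x, hx, hxW, rfl⟩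
    exact (hW u x hx).mp hxW

lemma HasLinearFibers.isClosed {A : Set (S.Control × RealProjectiveSpace d)}
    {W : S.Control → Submodule ℝ (Fin (d + 1) → ℝ)} (hW : HasLinearFibers A W) (hA : IsClosed A) :
    IsClosed {q : S.Control × (Fin (d + 1) → ℝ) | q.2 ∈ W q.1} := by
  classical
  rw [isClosed_iff_ultrafilter]
  rintro ⟨u, y⟩ F hF hmem
  by_cases hy : y = 0
  · simp [hy]
  have hu : Tendsto (fun q : S.Control × (Fin (d + 1) → ℝ) => q.1) F (𝓝 u) :=
    (continuous_fst.tendsto _).mono_left hF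
  have hx : Tendsto (fun q : S.Control × (Fin (d + 1) → ℝ) => q.2) F (𝓝 y) :=
    (continuous_snd.tendsto _).mono_left hF
  have hne : ∀ᶠ q in (F : Filter (S.Control × (Fin (d + 1) → ℝ))), q.2 ≠ 0 :=
    hx.eventually_ne hy
  -- Zero vectors are replaced by the dummy value `y`, so that every term has a projective class.
  let f : S.Control × (Fin (d + 1) → ℝ) → Fin (d + 1) → ℝ := fun q => if q.2 = 0 then y else q.2
  have hf0 : ∀ q, f q ≠ 0 := fun q => by
    by_cases h : q.2 = 0 <;> simp [f, h, hy]
  have hfq : ∀ q : S.Control × (Fin (d + 1) → ℝ), q.2 ≠ 0 → f q = q.2 := fun q h => if_neg h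
  have hf : Tendsto f F (𝓝 y) := hx.congr' (hne.mono fun q hq => (hfq q hq).symm)
  refine (hW u y hy).mpr (hA.mem_of_tendsto (hu.prodMk_nhds (tendsto_projMk hf0 hy hf)) ?_)
  filter_upwards [hne, hmem] with q hq hqW
  refine (hW q.1 _ (hf0 q)).mp ?_
  rw [hfq q hq]
  exact hqW

lemma HasLinearFibers.isInvariantSubbundle {A : Set (S.Control × RealProjectiveSpace d)}
    {W : S.Control → Submodule ℝ (Fin (d + 1) → ℝ)} (hW : HasLinearFibers A W) (hA : IsClosed A)
    (hinv : ∀ t, ∀ y ∈ A, S.controlFlow t y ∈ A)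
    (hdim : ∀ u v, Module.finrank ℝ (W u) = Module.finrank ℝ (W v)) :
    IsInvariantSubbundle W where
  finrank_eq := hdim
  isClosed := hW.isClosed hA
  flow_mem u t x hx := by
    by_cases hx0 : x = 0
    · rw [hx0, flow_apply_zero]; exact zero_mem _
    · refine (hW _ _ (flow_ne_zero u t hx0)).mpr ?_
      rw [← controlFlow_mk _ _ _ hx0]
      exact hinv t _ ((hW u x hx0).mp hx)

/-- The projective fibers of a subbundle depend lower semicontinuously on the control. -/
lemma IsInvariantSubbundle.lowerHemicontinuous {W : S.Control → Submodule ℝ (Fin (d + 1) → ℝ)}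
    (hW : IsInvariantSubbundle W) :
    LowerHemicontinuous fun u => (projectiveSubspace (W u) : Set (RealProjectiveSpace d)) := by
  rintro u V ⟨hVo, p, ⟨x, hx, hxW, rfl⟩, hpV⟩
  -- The space `Z ⊔ span {x}` has one dimension more than a complement of any `W v`, hence meets `W
  -- v` in a unit vector `z v`. Limits of `z v` as `v → u` lie in `W u ⊓ (Z ⊔ span {x})`, which is
  -- the line of `x`.
  obtain ⟨Z, hZ⟩ := Submodule.exists_isCompl (W u)
  have hex : ∀ v, ∃ z ∈ W v, ‖z‖ = 1 ∧ z ∈ Z ⊔ Submodule.span ℝ {x} := by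
    intro v
    have hZx : Z ⊓ Submodule.span ℝ {x} = ⊥ := by
      rw [eq_bot_iff]
      rintro y ⟨h1, h2⟩
      obtain ⟨c, rfl⟩ := Submodule.mem_span_singleton.mp h2
      exact Submodule.disjoint_def.mp hZ.disjoint _ ((W u).smul_mem c hxW) h1
    have h1 := Submodule.finrank_sup_add_finrank_inf_eq Z (Submodule.span ℝ {x})
    have h2 := Submodule.finrank_add_eq_of_isCompl hZ
    have h3 := Submodule.finrank_sup_add_finrank_inf_eq (W v) (Z ⊔ Submodule.span ℝ {x})
    have h4 := Submodule.finrank_le (W v ⊔ (Z ⊔ Submodule.span ℝ {x}))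
    have h5 := hW.finrank_eq u v
    rw [hZx, finrank_bot, finrank_span_singleton hx] at h1
    have hne : W v ⊓ (Z ⊔ Submodule.span ℝ {x}) ≠ ⊥ := by
      intro hbot
      rw [hbot, finrank_bot] at h3
      omega
    obtain ⟨z, ⟨hz1, hz2⟩, hz0⟩ := Submodule.exists_mem_ne_zero_of_ne_bot hne
    exact ⟨‖z‖⁻¹ • z, Submodule.smul_mem _ _ hz1, norm_smul_inv_norm hz0,
      Submodule.smul_mem _ _ hz2⟩
  choose z hzW hz1 hzZ using hex
  refine Filter.mem_iff_ultrafilter.mpr fun F hF => ?_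
  obtain ⟨y, hy1, hy⟩ := exists_tendsto_unit F hz1
  have hyW : y ∈ W u := by
    have hF' : Tendsto (fun v : S.Control => v) F (𝓝 u) := hF
    exact hW.isClosed.mem_of_tendsto (hF'.prodMk_nhds hy) (Eventually.of_forall hzW)
  have hyZ : y ∈ Z ⊔ Submodule.span ℝ {x} :=
    (Submodule.closed_of_finiteDimensional _).mem_of_tendsto hy (Eventually.of_forall hzZ)
  obtain ⟨a, ha, b, hb, rfl⟩ := Submodule.mem_sup.mp hyZ
  obtain ⟨c, rfl⟩ := Submodule.mem_span_singleton.mp hb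
  have ha0 : a = 0 := Submodule.disjoint_def.mp hZ.disjoint a
    ((Submodule.add_mem_iff_left _ ((W u).smul_mem c hxW)).mp hyW) ha
  have hlim := tendsto_projMk (fun v => unit_ne_zero (hz1 v)) (unit_ne_zero hy1) hy
  rw [projMk_eq_of_smul (unit_ne_zero hy1) hx (c := c) (by rw [ha0, zero_add])] at hlim
  filter_upwards [hlim (hVo.mem_nhds hpV)] with v hv
  exact ⟨hVo, _, ⟨z v, unit_ne_zero (hz1 v), hzW v, rfl⟩, hv⟩

/-- The projection of an isolated invariant set is isolated if the set is its lift. -/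
lemma exists_isolating_nhds [T2Space (S.Control × RealProjectiveSpace d)]
    [T2Space (RealProjectiveSpace d)]
    {A A' B R : Set (S.Control × RealProjectiveSpace d)}
    (hA : IsAttractorRepellerPair S.controlFlow A A')
    (hR : IsAttractorRepellerPair S.controlFlow B R)
    (hlift : ∀ u p, (∀ t, projFlow u t p ∈ Prod.snd '' (A ∩ R)) → (u, p) ∈ A ∩ R) :
    ∃ N ∈ 𝓝ˢ (Prod.snd '' (A ∩ R)), ∀ (u : S.Control) (p : RealProjectiveSpace d),
      (∀ t : ℝ, projFlow u t p ∈ N) → ∀ t : ℝ, projFlow u t p ∈ Prod.snd '' (A ∩ R) := by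
  have hflow := isContinuousFlow_controlFlow (S := S)
  have hL : IsClosed (A ∩ R) := hA.isClosed_left.inter hR.isClosed_right
  have hQ : IsClosed (Prod.snd '' (A ∩ R)) := (hL.isCompact.image continuous_snd).isClosed
  -- `O₁` surrounds `A ∩ R` and `O₂` surrounds the dual sets `A'` and `B`. An orbit avoiding `O₂`
  -- lies in `A ∩ R` by `mem_inter_of_orbit`.
  obtain ⟨O₁, O₂, hO₁, hO₂, hLO, hEO, hO⟩ := normal_separation hL
    (hA.isClosed_right.union hR.isClosed_left) (Set.disjoint_left.mpr fun y h1 h2 => h2.elim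
      (Set.disjoint_left.mp hA.disjoint h1.1) fun h3 => Set.disjoint_left.mp hR.disjoint h3 h1.2)
  -- By `hlift`, a point outside `O₁` has an orbit whose projection leaves the image of `A ∩ R`.
  -- Compactness of `O₁ᶜ` provides one neighborhood `N` that all these projected orbits leave.
  have hK : ∃ N ∈ 𝓝ˢ (Prod.snd '' (A ∩ R)), ∀ y ∈ O₁ᶜ, ∃ t, (S.controlFlow t y).2 ∉ N := by
    refine hO₁.isClosed_compl.isCompact.induction_on
      (p := fun s => ∃ N ∈ 𝓝ˢ (Prod.snd '' (A ∩ R)), ∀ y ∈ s, ∃ t, (S.controlFlow t y).2 ∉ N)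
      ⟨univ, univ_mem, fun y hy => hy.elim⟩ ?_ ?_ ?_
    · rintro s s' hs ⟨N, hN, h⟩
      exact ⟨N, hN, fun y hy => h y (hs hy)⟩
    · rintro s s' ⟨N, hN, h⟩ ⟨N', hN', h'⟩
      refine ⟨N ∩ N', inter_mem hN hN', fun y hy => ?_⟩
      rcases hy with hy | hy
      · obtain ⟨t, ht⟩ := h y hy
        exact ⟨t, fun h1 => ht h1.1⟩
      · obtain ⟨t, ht⟩ := h' y hy
        exact ⟨t, fun h1 => ht h1.2⟩
    · rintro ⟨u, p⟩ hy
      have hnot : ∃ t, projFlow u t p ∉ Prod.snd '' (A ∩ R) := by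
        by_contra! hcon
        exact hy (hLO (hlift u p hcon))
      obtain ⟨t, ht⟩ := hnot
      obtain ⟨V, N, hV, hN, hpV, hQN, hVN⟩ := normal_separation (isClosed_singleton
        (x := projFlow u t p)) hQ (Set.disjoint_singleton_left.mpr ht)
      refine ⟨(fun y => (S.controlFlow t y).2) ⁻¹' V, mem_nhdsWithin_of_mem_nhds
        ((continuous_snd.comp (hflow.continuous_time t)).continuousAt.preimage_mem_nhds
          (hV.mem_nhds (hpV rfl))), N, hN.mem_nhdsSet.mpr hQN, fun y hy => ⟨t, fun h => ?_⟩⟩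
      exact Set.disjoint_left.mp hVN hy h
  obtain ⟨N, hN, hKN⟩ := hK
  refine ⟨N, hN, fun u p hup t => ?_⟩
  have horb : ∀ s, S.controlFlow s (u, p) ∈ O₂ᶜ := by
    intro s
    refine Set.disjoint_left.mp hO ?_
    by_contra hs
    obtain ⟨r, hr⟩ := hKN _ hs
    rw [← hflow.map_add] at hr
    exact hr (hup _)
  have h1 : Disjoint O₂ᶜ A' := Set.disjoint_left.mpr fun y h1 h2 => h1 (hEO (Or.inl h2))
  have h2 : Disjoint O₂ᶜ B := Set.disjoint_left.mpr fun y h1 h2 => h1 (hEO (Or.inr h2))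
  have hmem : (u, p) ∈ A ∩ R := hA.mem_inter_of_orbit hR hO₂.isClosed_compl h1 h2 horb
  have hmem' : S.controlFlow t (u, p) ∈ A ∩ R :=
    ⟨hA.map_left t _ hmem.1, hR.map_right t _ hmem.2⟩
  exact ⟨_, hmem', rfl⟩

end BilinearSystem

/-! ### Proof of the theorem -/

theorem mainTheorem3 (d m : ℕ) (S : BilinearSystem d m)
    (D : S.Control × RealProjectiveSpace d → S.Control × RealProjectiveSpace d → ℝ)
    (hD : IsCompatibleMetric D)
    (Q : Set (RealProjectiveSpace d)) (hQ : S.IsChainControlSet D Q) :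
    (∃ W : S.Control → Submodule ℝ (Fin (d + 1) → ℝ),
      BilinearSystem.IsInvariantSubbundle W ∧
      IsChainRecurrentComponent S.controlFlow D {q | q.2 ∈ projectiveSubspace (W q.1)} ∧
      (Q = ⋃ u, projectiveSubspace (W u)) ∧
      ∀ u, S.fiber Q u = projectiveSubspace (W u)) ∧
    LowerHemicontinuous (S.fiber Q) ∧
    ∃ N ∈ 𝓝ˢ Q, ∀ (u : S.Control) (p : RealProjectiveSpace d),
      (∀ t : ℝ, BilinearSystem.projFlow u t p ∈ N) →
        ∀ t : ℝ, BilinearSystem.projFlow u t p ∈ Q := by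
  obtain ⟨L, hcomp, rfl⟩ := hQ
  obtain ⟨q, hq, hL⟩ := id hcomp
  have hT2 : T2Space (S.Control × RealProjectiveSpace d) := hD.t2Space
  -- The slice over `q.1` embeds projective space into a metrizable space.
  have hT2' : T2Space (RealProjectiveSpace d) :=
    T2Space.of_injective_continuous (f := fun p => (q.1, p)) (fun p p' h => congrArg Prod.snd h)
      (by fun_prop)
  have hflow := BilinearSystem.isContinuousFlow_controlFlow (S := S)
  obtain ⟨A, A', hA, hAm, hAL⟩ := hD.exists_attractors hflow q
  obtain ⟨B, R, hR, hRm, hRL⟩ := hD.exists_repellers hflow q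
  choose W hW using fun n => (hA n).exists_left
  choose W' hW' using fun n => (hA n).exists_right
  choose V' hV' using fun n => (hR n).exists_left
  choose V hV using fun n => (hR n).exists_right
  obtain ⟨k, hk⟩ := BilinearSystem.exists_eq_iInter hW (fun n u v => by
    have h1 := (hA n).finrank_add (hW n) (hW' n) u u
    have h2 := (hA n).finrank_add (hW n) (hW' n) v u
    omega) hAm
  obtain ⟨l, hl⟩ := BilinearSystem.exists_eq_iInter hV (fun n u v => by
    have h1 := (hR n).finrank_add (hV' n) (hV n) u u
    have h2 := (hR n).finrank_add (hV' n) (hV n) u v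
    omega) hRm
  have hLAR : L = A k ∩ R l := by
    rw [← hk, ← hl, ← hAL, ← hRL, hL]
    rfl
  have hqL : q ∈ L := by
    rw [hL]
    exact ⟨hq, hq⟩
  have hne : (A k ∩ R l).Nonempty := ⟨q, hLAR ▸ hqL⟩
  have hX : BilinearSystem.HasLinearFibers L (fun u => W k u ⊓ V l u) := by
    intro u x hx
    rw [hLAR]
    exact and_congr (hW k u x hx) (hV l u x hx)
  have hLc : IsClosed L := hLAR ▸ (hA k).isClosed_left.inter (hR l).isClosed_right
  have hLinv : ∀ t, ∀ y ∈ L, S.controlFlow t y ∈ L := by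
    rw [hLAR]
    exact fun t y hy => ⟨(hA k).map_left t y hy.1, (hR l).map_right t y hy.2⟩
  have hLtrans : ∀ a ∈ L, ∀ b ∈ L, ChainReaches S.controlFlow D a b := by
    rw [hL]
    exact fun a ha b hb => ha.2.trans hb.1
  have horb : ∀ y ∈ L, ∀ t, BilinearSystem.projFlow y.1 t y.2 ∈ Prod.snd '' L :=
    fun y hy t => ⟨_, hLinv t y hy, rfl⟩
  -- This is what identifies `Q(u)`: an orbit staying in `Q` is joined to `q` by chains in both
  -- directions and so belongs to the component.
  have hlift : ∀ u p, (∀ t, BilinearSystem.projFlow u t p ∈ Prod.snd '' L) → (u, p) ∈ L := by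
    intro u p hup
    rw [hL]
    exact ⟨BilinearSystem.chainReaches_of_orbits hD hLtrans (horb q hqL) hup,
      BilinearSystem.chainReaches_of_orbits hD hLtrans hup (horb q hqL)⟩
  have hfib : ∀ u, S.fiber (Prod.snd '' L) u = projectiveSubspace (W k u ⊓ V l u) := by
    intro u
    ext p
    rw [← hX.mem_iff]
    exact ⟨hlift u p, fun h => horb (u, p) h⟩
  have hdim : ∀ u v, Module.finrank ℝ (W k u ⊓ V l u : Submodule ℝ (Fin (d + 1) → ℝ)) =
      Module.finrank ℝ (W k v ⊓ V l v : Submodule ℝ (Fin (d + 1) → ℝ)) := fun u v =>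
    BilinearSystem.finrank_inf_eq (hA k) (hR l) hne (hW k) (hV l) u v
  have hbundle := hX.isInvariantSubbundle hLc hLinv hdim
  refine ⟨⟨_, hbundle, ?_, ?_, hfib⟩, ?_, ?_⟩
  · have : {q : S.Control × RealProjectiveSpace d |
        q.2 ∈ projectiveSubspace (W k q.1 ⊓ V l q.1)} = L := by
      ext y
      exact (hX.mem_iff y.1 y.2).symm
    rwa [this]
  · ext p
    simp only [mem_iUnion, ← hX.mem_iff, mem_image, Prod.exists, exists_eq_right]
  · rw [show S.fiber (Prod.snd '' L) = _ from funext hfib]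
    exact hbundle.lowerHemicontinuous
  · rw [hLAR] at hlift ⊢
    exact BilinearSystem.exists_isolating_nhds (hA k) (hR l) hlift
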